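/- Let $q$ be a prime power, let $0\le k\le n$ be integers and let $\alpha=(\alpha_1,\dots,\alpha_\ell)$ be a composition of $n$ into positive parts. Let the torus $T_\alpha=\prod_{r=1}^{\ell}\mathbb F_{q^{\alpha_r}}^\times$ act by componentwise multiplication on the $n$-dimensional $\mathbb F_q$-vector space $V_\alpha=\bigoplus_{r=1}^{\ell}\mathbb F_{q^{\alpha_r}}$, and hence on the finite set $G_k(V_\alpha)$ of its $k$-dimensional $\mathbb F_q$-subspaces. For a partition $\lambda=(\lambda_1\ge\dots\ge\lambda_k\ge 0)$ with $\lambda_1\le n-k$ (written $\lambda\subset(n-k)^k$), consider a $k\times n$ array whose row $i$ (rows numbered from top to bottom) has its pivot in column $p_i=\lambda_i+k-i+1$ and has a star in each column $c<p_i$ that is not one of the pivot columns $p_1,\dots,p_k$; so row $i$ has $\lambda_i$ stars. Divide the columns into consecutive blocks of sizes $\alpha_1,\dots,\alpha_\ell$, labeled $1,\dots,\ell$ from right to left. A row belongs to row block $r$ if its pivot lies in column block $r$; let $\beta_r$ be the number of such rows. For $1\le r\le s\le\ell$, let $\lambda^{r,s}$ be the set of stars (cells) in row block $r$ and column block $s$.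 It lies in the $\beta_r\times(\alpha_s-\beta_s)$ box formed by the rows of block $r$ and the non-pivot columns of block $s$. For $x\in\lambda^{r,s}$ let $i(x)$ and $j(x)$ be the horizontal and the vertical distance of $x$ from the bottom-left cell of this box. With the $q$-numbers $[a,b]=\frac{a^q-b^q}{a-b}=\sum_{i+j=q-1}a^ib^j$, put $$\mathrm{wt}(\lambda;\alpha,k)=\prod_{1\le r\le s\le\ell}\ \prod_{x\in\lambda^{r,s}}\Big[t_r^{\,q^{i(x)+j(x)}},\,t_s^{\,q^{i(x)+\beta_r}}\Big]\in\mathbb Z[t_1,\dots,t_\ell],\qquad X(t_1,\dots,t_\ell)=\sum_{\lambda\subset(n-k)^k}\mathrm{wt}(\lambda;\alpha,k).$$ Then the triple $\big(G_k(V_\alpha),\,X,\,T_\alpha\big)$ exhibits the cyclic sieving phenomenon: there are injective group homomorphisms $\omega_r:\mathbb F_{q^{\alpha_r}}^\times\to\mathbb C^\times$ $(1\le r\le\ell)$ such that for every $u=(u_1,\dots,u_\ell)\in T_\alpha$, $$X\big(\omega_1(u_1),\dots,\omega_\ell(u_\ell)\big)=\#\{W\in G_k(V_\alpha): uW=W\}.$$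 Moreover, this identity holds for all $u\in T_\alpha$ whenever the $\omega_r$ are induced by one common embedding, that is, whenever $\omega_r=\omega\circ\iota_r$ for some field extension $L$ of $\mathbb F_q$, some injective group homomorphism $\omega:L^\times\to\mathbb C^\times$ and some $\mathbb F_q$-algebra homomorphisms $\iota_r:\mathbb F_{q^{\alpha_r}}\to L$. -/

import Mathlib

open MvPolynomial

noncomputable section

namespace TorusSieving

/-! ### The cyclic sieving phenomenon -/

/-- The sieving identity for chosen homomorphisms `ω i : C i → ℂˣ`: evaluating `P` at
`t_i = ω_i(c_i)` counts the points of `X` that are fixed by `c`, for every `c`. -/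
def SievesFor {ι : Type*} {C : ι → Type*} [∀ i, CommGroup (C i)] (X : Type*)
    [MulAction (∀ i, C i) X] (P : MvPolynomial ι ℤ) (ω : ∀ i, C i →* ℂˣ) : Prop :=
  ∀ c : ∀ i, C i,
    aeval (fun i => ((ω i (c i) : ℂˣ) : ℂ)) P = (Nat.card (MulAction.fixedBy X c) : ℂ)

/-- The triple `(X, P, ∏ C i)` exhibits the cyclic sieving phenomenon: `X` is a finite set, the
`C i` are finite cyclic groups, and the sieving identity holds after choosing suitable
embeddings `C i ↪ ℂˣ`. -/
def ExhibitsCSP {ι : Type*} (X : Type*) (P : MvPolynomial ι ℤ) (C : ι → Type*)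
    [∀ i, CommGroup (C i)] [MulAction (∀ i, C i) X] : Prop :=
  Finite X ∧ (∀ i, Finite (C i) ∧ IsCyclic (C i)) ∧
    ∃ ω : ∀ i, C i →* ℂˣ, (∀ i, Function.Injective (ω i)) ∧ SievesFor X P ω

/-! ### Partitions in a box and their weights

Rows are numbered `0, …, k - 1` from top to bottom, columns `0, …, n - 1` from left to right, and
the blocks of columns are numbered by `Fin ℓ` from right to left. -/

/-- The partitions `λ ⊂ (n - k)^k`: weakly decreasing sequences of `k` numbers, each at most
`n - k`. -/
def boxPartitions (n k : ℕ) : Finset (Fin k → ℕ) :=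
  open Classical in
  (Fintype.piFinset fun _ : Fin k => Finset.range (n - k + 1)).filter (fun lam => Antitone lam)

/-- The pivot column of row `i` of the row echelon form of `lam`. -/
def pivot {k : ℕ} (lam : Fin k → ℕ) (i : Fin k) : ℕ := lam i + (k - 1 - (i : ℕ))

/-- The columns of the `s`-th block. There are `α s` of them, and the columns to their left are
those of the blocks `s' > s`. -/
def blockCols {ℓ : ℕ} (α : Fin ℓ → ℕ) (s : Fin ℓ) : Finset ℕ :=
  Finset.Ico (∑ s' ∈ Finset.Ioi s, α s') (∑ s' ∈ Finset.Ioi s, α s' + α s)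

/-- The rows of the `r`-th block: those with their pivot in the `r`-th block of columns. -/
def blockRows {ℓ k : ℕ} (α : Fin ℓ → ℕ) (lam : Fin k → ℕ) (r : Fin ℓ) : Finset (Fin k) :=
  Finset.univ.filter fun i => pivot lam i ∈ blockCols α r

/-- `β(λ)_r`, the number of pivots in the `r`-th block of columns. -/
def beta {ℓ k : ℕ} (α : Fin ℓ → ℕ) (lam : Fin k → ℕ) (r : Fin ℓ) : ℕ :=
  (blockRows α lam r).card

/-- The columns of the `s`-th block that are not pivot columns. -/
def freeCols {ℓ k : ℕ} (α : Fin ℓ → ℕ) (lam : Fin k → ℕ) (s : Fin ℓ) : Finset ℕ :=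
  (blockCols α s).filter fun c => ∀ i : Fin k, pivot lam i ≠ c

/-- The cells of `λ^{r,s}`, that is the stars in block `(r, s)` of the row echelon form: a star
stands in each non-pivot column to the left of the pivot of its row. -/
def cells {ℓ k : ℕ} (α : Fin ℓ → ℕ) (lam : Fin k → ℕ) (r s : Fin ℓ) : Finset (Fin k × ℕ) :=
  (blockRows α lam r ×ˢ freeCols α lam s).filter fun x => x.2 < pivot lam x.1

/-- `i(x)`: the horizontal distance of `x` from the bottom-left cell of the
`β_r`-by-`(α_s - β_s)` box formed by the rows of block `r` and the non-pivot columns of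
block `s`. -/
def hdist {ℓ k : ℕ} (α : Fin ℓ → ℕ) (lam : Fin k → ℕ) (s : Fin ℓ) (x : Fin k × ℕ) : ℕ :=
  ((freeCols α lam s).filter fun c => c < x.2).card

/-- `j(x)`: the vertical distance of `x` from the bottom-left cell of that box. -/
def vdist {ℓ k : ℕ} (α : Fin ℓ → ℕ) (lam : Fin k → ℕ) (r : Fin ℓ) (x : Fin k × ℕ) : ℕ :=
  ((blockRows α lam r).filter fun i => x.1 < i).card

/-- The `q`-number `[a, b] = (a^q - b^q) / (a - b) = ∑_{i + j = q - 1} a^i b^j`. -/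
def qNumber {R : Type*} [CommRing R] (q : ℕ) (a b : R) : R :=
  ∑ i ∈ Finset.range q, a ^ i * b ^ (q - 1 - i)

/-- The weight `wt(λ^{r,s}; t_r, t_s)`. -/
def blockWeight {ℓ k : ℕ} (q : ℕ) (α : Fin ℓ → ℕ) (lam : Fin k → ℕ) (r s : Fin ℓ) :
    MvPolynomial (Fin ℓ) ℤ :=
  ∏ x ∈ cells α lam r s,
    qNumber q ((X r : MvPolynomial (Fin ℓ) ℤ) ^ q ^ (hdist α lam s x + vdist α lam r x))
      ((X s : MvPolynomial (Fin ℓ) ℤ) ^ q ^ (hdist α lam s x + beta α lam r))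

/-- The weight `wt(λ; α, k)`. -/
def weight {ℓ k : ℕ} (q : ℕ) (α : Fin ℓ → ℕ) (lam : Fin k → ℕ) : MvPolynomial (Fin ℓ) ℤ :=
  ∏ r : Fin ℓ, ∏ s ∈ Finset.Ici r, blockWeight q α lam r s

/-! ### The torus and the Grassmannian -/

/-- The set `G_k(V)` of `k`-dimensional subspaces of `V`. -/
def Gr (F : Type*) [Field F] (k : ℕ) (V : Type*) [AddCommGroup V] [Module F V] : Type _ :=
  {W : Submodule F V // Module.finrank F W = k}

section Torus

variable (F : Type*) [Field F] {ι : Type*} {E : ι → Type*} [∀ i, Field (E i)]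
  [∀ i, Algebra F (E i)]

/-- Componentwise multiplication by `u ∈ ∏ (E i)ˣ` on `⨁ E i`, as an `F`-linear map. -/
def torusMap (u : ∀ i, (E i)ˣ) : (∀ i, E i) →ₗ[F] (∀ i, E i) :=
  LinearMap.pi fun i => (LinearMap.mulLeft F (u i : E i)).comp (LinearMap.proj i)

theorem torusMap_apply (u : ∀ i, (E i)ˣ) (v : ∀ i, E i) (i : ι) :
    torusMap F u v i = (u i : E i) * v i := rfl

theorem torusMap_injective (u : ∀ i, (E i)ˣ) :
    Function.Injective (torusMap F u : (∀ i, E i) → (∀ i, E i)) := by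
  intro v w h
  funext i
  have hi := congrFun h i
  rw [torusMap_apply, torusMap_apply] at hi
  exact mul_left_cancel₀ (u i).ne_zero hi

/-- The torus `∏ (E i)ˣ` acts on the `k`-dimensional subspaces of `⨁ E i`: `u` sends `W` to its
image under componentwise multiplication by `u`. -/
instance torusAction (k : ℕ) : MulAction (∀ i, (E i)ˣ) (Gr F k (∀ i, E i)) where
  smul u W := ⟨W.1.map (torusMap F u),
    (LinearEquiv.finrank_eq (Submodule.equivMapOfInjective _ (torusMap_injective F u) W.1)).symm.trans
      W.2⟩
  one_smul W := by
    apply Subtype.ext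
    change W.1.map (torusMap F 1) = W.1
    have h : torusMap F (1 : ∀ i, (E i)ˣ) = LinearMap.id := by
      ext v i
      simp [torusMap_apply]
    rw [h, Submodule.map_id]
  mul_smul u w W := by
    apply Subtype.ext
    change W.1.map (torusMap F (u * w)) = (W.1.map (torusMap F w)).map (torusMap F u)
    have h : torusMap F (u * w) = (torusMap F u).comp (torusMap F w) := by
      apply LinearMap.ext
      intro v
      funext i
      simp [torusMap_apply, mul_assoc]
    rw [h, Submodule.map_comp]

end Torus

/-- The polynomial `∑_{λ ⊂ (n - k)^k} wt(λ; α, k)`. -/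
def sievingPolynomial {ℓ : ℕ} (q n k : ℕ) (α : Fin ℓ → ℕ) : MvPolynomial (Fin ℓ) ℤ :=
  ∑ lam ∈ boxPartitions n k, weight q α lam

end TorusSieving

end

noncomputable section

namespace TorusSieving

/-! ### Sums over subsets of a single block -/

/-! Fix `u` and let `A = F[u]` inside `∏ E r`. The subspaces fixed by `u` are the `A`-submodules of
`⨁ E r`. The ring `A` is finite and reduced, hence semisimple, and `E r` is a power `(A/I_r)^{a_r}`,
where `I_r` is the kernel of the projection `A → E r`. With `d_r = [A/I_r : F]`, so that `α_r = d_r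
a_r`, both sides of the identity equal the sum over `b` with `∑ d_r b_r = k` of `∏_r [a_r choose
b_r]_{q^{d_r}} · ∏_{r<s} #Hom(A/I_r, A/I_s)^{b_r (a_s - b_s)}`.

Fixed points: a submodule `W` of `Q × N` amounts to its image `B` in `Q`, its intersection `A'` with
`N`, and a homomorphism `B → N/A'` (`card_fiber`). Splitting off one `E r` at a time gives the sum
(`finsum_submodule_pi`). The Hom sets have `q^{d_r}` elements if `I_r = I_s`, and one element
otherwise.

Polynomial: a partition is a set of pivot columns, and for `r < s` all cells of block `(r, s)` are
stars. So `X` is a sum over pivot numbers `β` of diagonal sums `subsetSum` times full boxes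
`boxWeight` (`sievingPolynomial_eq`). The diagonal sum is the quotient of `∏ (t^{q^α} - t^{q^i})` by
`∏ (t^{q^β} - t^{q^i})` over `i < β` (`subsetSum_mul_prod`). Let `z_r = ω_r(u_r)`, which has period
`d_r` under `x ↦ x^q`. Comparing orders of vanishing at `z_r` shows that the quotient is zero unless
`d_r ∣ β_r`, and is then a Gaussian binomial in `q^{d_r}`. The boxes telescope: each is a power of
`q` if `z_r` and `z_s` are conjugate under `x ↦ x^q`, and 1 otherwise (`boxWeight_of_conj`,
`boxWeight_of_ne`). A common embedding makes this conjugacy equivalent to `I_r = I_s`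
(`ker_eq_ker_iff`). -/

theorem qNumber_mul_sub {R : Type*} [CommRing R] (q : ℕ) (a b : R) :
    qNumber q a b * (a - b) = a ^ q - b ^ q := by
  unfold qNumber
  exact geom_sum₂_mul a b q

/-- A product over a finite set of naturals of a function of the rank is a product over a range. -/
theorem prod_rank {M : Type*} [CommMonoid M] (S : Finset ℕ) (f : ℕ → M) :
    ∏ p ∈ S, f (S.filter (fun x => x < p)).card = ∏ j ∈ Finset.range S.card, f j := by
  induction S using Finset.induction_on_max with
  | empty => simp
  | insert a S ha ih =>
    have haS : a ∉ S := fun h => lt_irrefl _ (ha a h)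
    rw [Finset.prod_insert haS, Finset.card_insert_of_notMem haS, Finset.prod_range_succ, ← ih,
      mul_comm]
    congr 1
    · apply Finset.prod_congr rfl
      intro p hp
      rw [Finset.filter_insert, if_neg (not_lt.mpr (ha p hp).le)]
    · rw [Finset.filter_insert, if_neg (lt_irrefl a), Finset.filter_true_of_mem ha]

/-- The weight of the set `S ⊆ C` of pivot columns in a single block `C` of columns. -/
def subsetWeight {R : Type*} [CommRing R] (q : ℕ) (t : R) (C S : Finset ℕ) : R :=
  ∏ p ∈ S, ∏ c ∈ (C \ S).filter (fun c => c < p),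
    qNumber q (t ^ q ^ (((C \ S).filter (fun x => x < c)).card + (S.filter (fun x => x < p)).card))
      (t ^ q ^ (((C \ S).filter (fun x => x < c)).card + S.card))

/-- The sum of the weights of the `k`-element sets of pivot columns in a single block `C`. -/
def subsetSum {R : Type*} [CommRing R] (q : ℕ) (t : R) (C : Finset ℕ) (k : ℕ) : R :=
  ∑ S ∈ C.powersetCard k, subsetWeight q t C S

/-- A pivot in the leftmost column has no stars in its row, but it lies below all other rows: `j(x)`
and the number of rows grow by one, which amounts to `t ↦ t^q`. -/
theorem subsetWeight_insert_insert {R : Type*} [CommRing R] (q : ℕ) (t : R) {C S : Finset ℕ}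
    {a : ℕ} (ha : ∀ x ∈ C, a < x) (hS : S ⊆ C) :
    subsetWeight q t (insert a C) (insert a S) = subsetWeight q (t ^ q) C S := by
  have haC : a ∉ C := fun h => lt_irrefl _ (ha a h)
  have haS : a ∉ S := fun h => haC (hS h)
  have hd : insert a C \ insert a S = C \ S := by
    rw [Finset.insert_sdiff_insert, Finset.sdiff_insert_of_notMem haC]
  unfold subsetWeight
  rw [Finset.prod_insert haS, hd]
  have h0 : (C \ S).filter (fun c => c < a) = ∅ := by
    rw [Finset.filter_eq_empty_iff]
    intro x hx
    exact not_lt.mpr (ha x (Finset.mem_sdiff.mp hx).1).le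
  rw [h0, Finset.prod_empty, one_mul]
  apply Finset.prod_congr rfl
  intro p hp
  apply Finset.prod_congr rfl
  intro c _
  rw [Finset.filter_insert, if_pos (ha p (hS hp)), Finset.card_insert_of_notMem (by simp [haS]),
    Finset.card_insert_of_notMem haS, ← pow_mul, ← pow_mul, ← pow_succ', ← pow_succ']
  rfl

/-- A free leftmost column has a star in every row, which accounts for the product. It moves all
other stars one step to the right, which again amounts to `t ↦ t^q`. -/
theorem subsetWeight_insert {R : Type*} [CommRing R] (q : ℕ) (t : R) {C S : Finset ℕ}
    {a : ℕ} (ha : ∀ x ∈ C, a < x) (hS : S ⊆ C) :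
    subsetWeight q t (insert a C) S =
      (∏ j ∈ Finset.range S.card, qNumber q (t ^ q ^ j) (t ^ q ^ S.card)) *
        subsetWeight q (t ^ q) C S := by
  have haC : a ∉ C := fun h => lt_irrefl _ (ha a h)
  have haS : a ∉ S := fun h => haC (hS h)
  have hd : insert a C \ S = insert a (C \ S) := Finset.insert_sdiff_of_notMem _ haS
  unfold subsetWeight
  rw [hd, ← prod_rank S (fun j => qNumber q (t ^ q ^ j) (t ^ q ^ S.card)),
    ← Finset.prod_mul_distrib]
  apply Finset.prod_congr rfl
  intro p hp
  rw [Finset.filter_insert, if_pos (ha p (hS hp)), Finset.prod_insert (by simp [haC])]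
  have h0 : (insert a (C \ S)).filter (fun c => c < a) = ∅ := by
    rw [Finset.filter_eq_empty_iff]
    intro x hx
    rcases Finset.mem_insert.mp hx with rfl | hx
    · exact lt_irrefl _
    · exact not_lt.mpr (ha x (Finset.mem_sdiff.mp hx).1).le
  rw [h0, Finset.card_empty, zero_add, zero_add]
  congr 1
  apply Finset.prod_congr rfl
  intro c hc
  have hc' : c ∈ C := (Finset.mem_sdiff.mp (Finset.mem_filter.mp hc).1).1
  rw [Finset.filter_insert, if_pos (ha c hc'), Finset.card_insert_of_notMem (by simp [haC]),
    ← pow_mul, ← pow_mul, ← pow_succ', ← pow_succ', add_right_comm, add_right_comm _ 1]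

theorem subsetSum_zero {R : Type*} [CommRing R] (q : ℕ) (t : R) (C : Finset ℕ) :
    subsetSum q t C 0 = 1 := by
  simp [subsetSum, subsetWeight]

/-- The Pascal recursion, according to whether the leftmost column is free or a pivot. The variable
changes to `t^q`, so inductions must keep `t` general. -/
theorem subsetSum_insert {R : Type*} [CommRing R] (q : ℕ) (t : R) {C : Finset ℕ}
    {a : ℕ} (ha : ∀ x ∈ C, a < x) (k : ℕ) :
    subsetSum q t (insert a C) (k + 1) =
      (∏ j ∈ Finset.range (k + 1), qNumber q (t ^ q ^ j) (t ^ q ^ (k + 1))) *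
        subsetSum q (t ^ q) C (k + 1) + subsetSum q (t ^ q) C k := by
  have haC : a ∉ C := fun h => lt_irrefl _ (ha a h)
  unfold subsetSum
  rw [Finset.powersetCard_succ_insert haC, Finset.sum_union, Finset.mul_sum]
  · congr 1
    · apply Finset.sum_congr rfl
      intro S hS
      rw [Finset.mem_powersetCard] at hS
      rw [subsetWeight_insert q t ha hS.1, hS.2]
    · rw [Finset.sum_image]
      · apply Finset.sum_congr rfl
        intro S hS
        rw [Finset.mem_powersetCard] at hS
        rw [subsetWeight_insert_insert q t ha hS.1]
      · intro S hS T hT h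
        rw [Finset.mem_coe, Finset.mem_powersetCard] at hS hT
        have := congrArg (fun U => Finset.erase U a) h
        simpa [Finset.erase_insert (fun h => haC (hS.1 h)),
          Finset.erase_insert (fun h => haC (hT.1 h))] using this
  · rw [Finset.disjoint_left]
    intro S hS hS'
    obtain ⟨T, _, rfl⟩ := Finset.mem_image.mp hS'
    exact haC ((Finset.mem_powersetCard.mp hS).1 (Finset.mem_insert_self a T))

/-- The product formula for the sum over the subsets of a single block. -/
theorem subsetSum_mul_prod {R : Type*} [CommRing R] (q : ℕ) (C : Finset ℕ) :
    ∀ (t : R) (k : ℕ), subsetSum q t C k * ∏ i ∈ Finset.range k, (t ^ q ^ k - t ^ q ^ i) =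
      ∏ i ∈ Finset.range k, (t ^ q ^ C.card - t ^ q ^ i) := by
  induction C using Finset.induction_on_min with
  | empty =>
    intro t k
    rcases k with _ | k
    · simp [subsetSum_zero]
    · rw [Finset.prod_range_succ' (fun i => t ^ q ^ (∅ : Finset ℕ).card - t ^ q ^ i)]
      have h : Finset.powersetCard (k + 1) (∅ : Finset ℕ) = ∅ :=
        Finset.powersetCard_eq_empty.mpr (by simp)
      simp [subsetSum, h]
  | insert a C ha ih =>
    intro t k
    rcases k with _ | k
    · simp [subsetSum_zero]
    have haC : a ∉ C := fun h => lt_irrefl _ (ha a h)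
    rw [subsetSum_insert q t ha, Finset.card_insert_of_notMem haC]
    have h1 := ih (t ^ q) (k + 1)
    have h2 := ih (t ^ q) k
    simp only [← pow_mul, ← pow_succ'] at h1 h2
    have hc : (∏ j ∈ Finset.range (k + 1), qNumber q (t ^ q ^ j) (t ^ q ^ (k + 1))) *
        ∏ i ∈ Finset.range (k + 1), (t ^ q ^ (k + 1) - t ^ q ^ i) =
        ∏ i ∈ Finset.range (k + 1), (t ^ q ^ (k + 1 + 1) - t ^ q ^ (i + 1)) := by
      rw [← Finset.prod_mul_distrib]
      apply Finset.prod_congr rfl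
      intro j _
      have := qNumber_mul_sub q (t ^ q ^ j) (t ^ q ^ (k + 1))
      rw [← pow_mul, ← pow_mul, ← pow_succ, ← pow_succ] at this
      linear_combination -this
    -- With `T = t^{q^{|C|+1}}`, both summands contain `∏_{i<k} (T - t^{q^{i+1}})`. The remaining
    -- factors `T - t^{q^{k+1}}` and `t^{q^{k+1}} - t` add up to `T - t`.
    rw [add_mul, mul_right_comm, hc, mul_comm _ (subsetSum _ _ _ (k + 1)), h1,
      Finset.prod_range_succ' (fun i => t ^ q ^ (k + 1) - t ^ q ^ i), ← mul_assoc, h2,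
      Finset.prod_range_succ, Finset.prod_range_succ' (fun i => t ^ q ^ (C.card + 1) - t ^ q ^ i)]
    ring

/-! ### The single block sum at roots of unity -/

theorem map_qNumber {R S : Type*} [CommRing R] [CommRing S] (f : R →+* S) (q : ℕ) (a b : R) :
    f (qNumber q a b) = qNumber q (f a) (f b) := by
  simp [qNumber]

theorem map_subsetSum {R S : Type*} [CommRing R] [CommRing S] (f : R →+* S) (q : ℕ) (t : R)
    (C : Finset ℕ) (k : ℕ) : f (subsetSum q t C k) = subsetSum q (f t) C k := by
  simp [subsetSum, subsetWeight, map_qNumber]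

/-- `z` has period `d` under `x ↦ x ^ q`. -/
def HasFrobeniusPeriod {R : Type*} [Monoid R] (q d : ℕ) (z : R) : Prop :=
  ∀ i j, z ^ q ^ i = z ^ q ^ j ↔ i ≡ j [MOD d]

theorem HasFrobeniusPeriod.pow_eq_self {R : Type*} [Monoid R] {q d i : ℕ} {z : R}
    (hz : HasFrobeniusPeriod q d z) (hi : d ∣ i) : z ^ q ^ i = z := by
  simpa using (hz i 0).mpr ((Nat.modEq_zero_iff_dvd).mpr hi)

open scoped Polynomial in
-- For `i < n` every nonzero root `z` is simple: `z` times the derivative at `z` is `(q^n - q^i)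
-- z^{q^n}`, which is nonzero. The period decides whether `z` is a root at all.
theorem exists_factor {q d n i : ℕ} (hq : 1 < q) (hi : i < n) {z : ℂ} (hz0 : z ≠ 0)
    (hz : HasFrobeniusPeriod q d z) :
    ∃ e : ℂ[X], (Polynomial.X : ℂ[X]) ^ q ^ n - Polynomial.X ^ q ^ i =
        (Polynomial.X - Polynomial.C z) ^ (if i ≡ n [MOD d] then 1 else 0) * e ∧
      e.eval z ≠ 0 ∧
      (d ∣ n → e.eval z = if d ∣ i then (q : ℂ) ^ n - (q : ℂ) ^ i else z - z ^ q ^ i) := by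
  by_cases h : i ≡ n [MOD d]
  · have hroot : ((Polynomial.X : ℂ[X]) ^ q ^ n - Polynomial.X ^ q ^ i).IsRoot z := by
      simp [(hz i n).mpr h]
    obtain ⟨e, he⟩ := Polynomial.dvd_iff_isRoot.mpr hroot
    have hd : e.eval z = (q : ℂ) ^ n * z ^ (q ^ n - 1) - (q : ℂ) ^ i * z ^ (q ^ i - 1) := by
      have := congrArg (fun f => (Polynomial.derivative f).eval z) he
      simpa [Polynomial.derivative_mul, Polynomial.derivative_X_pow] using this.symm
    have hmul : e.eval z * z = ((q : ℂ) ^ n - (q : ℂ) ^ i) * z ^ q ^ n := by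
      have h1 : z ^ (q ^ n - 1) * z = z ^ q ^ n := by
        rw [← pow_succ, Nat.sub_add_cancel (Nat.one_le_pow _ _ (by omega))]
      have h2 : z ^ (q ^ i - 1) * z = z ^ q ^ n := by
        rw [← pow_succ, Nat.sub_add_cancel (Nat.one_le_pow _ _ (by omega)), (hz i n).mpr h]
      rw [hd]
      linear_combination (q : ℂ) ^ n * h1 - (q : ℂ) ^ i * h2
    have hne : (q : ℂ) ^ n - (q : ℂ) ^ i ≠ 0 := by
      rw [sub_ne_zero]
      exact_mod_cast (Nat.pow_lt_pow_right hq hi).ne'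
    refine ⟨e, by rw [if_pos h, pow_one, he], ?_, ?_⟩
    · intro h0
      rw [h0, zero_mul] at hmul
      exact mul_ne_zero hne (pow_ne_zero _ hz0) hmul.symm
    · intro hn
      have hi : d ∣ i := (h.dvd_iff dvd_rfl).mpr hn
      rw [hz.pow_eq_self hn] at hmul
      rw [if_pos hi]
      exact mul_right_cancel₀ hz0 hmul
  · refine ⟨Polynomial.X ^ q ^ n - Polynomial.X ^ q ^ i, by simp [h], ?_, ?_⟩
    · simp only [Polynomial.eval_sub, Polynomial.eval_pow, Polynomial.eval_X]
      rw [sub_ne_zero]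
      exact fun h' => h ((hz i n).mp h'.symm)
    · intro hn
      have hi : ¬ d ∣ i := fun hi => h (by
        rw [Nat.ModEq, Nat.mod_eq_zero_of_dvd hi, Nat.mod_eq_zero_of_dvd hn])
      simp [hi, hz.pow_eq_self hn]

open scoped Polynomial in
theorem exists_prod_factor {q d n k : ℕ} (hq : 1 < q) (hk : k ≤ n) {z : ℂ} (hz0 : z ≠ 0)
    (hz : HasFrobeniusPeriod q d z) :
    ∃ e : ℂ[X], ∏ i ∈ Finset.range k, ((Polynomial.X : ℂ[X]) ^ q ^ n - Polynomial.X ^ q ^ i) =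
        (Polynomial.X - Polynomial.C z) ^ (k.count (· ≡ n [MOD d])) * e ∧
      e.eval z ≠ 0 ∧
      (d ∣ n → e.eval z = ∏ i ∈ Finset.range k,
        if d ∣ i then (q : ℂ) ^ n - (q : ℂ) ^ i else z - z ^ q ^ i) := by
  have H : ∀ i : ℕ, ∃ e : ℂ[X], i < k → (Polynomial.X : ℂ[X]) ^ q ^ n - Polynomial.X ^ q ^ i =
        (Polynomial.X - Polynomial.C z) ^ (if i ≡ n [MOD d] then 1 else 0) * e ∧
      e.eval z ≠ 0 ∧
      (d ∣ n → e.eval z = if d ∣ i then (q : ℂ) ^ n - (q : ℂ) ^ i else z - z ^ q ^ i) := by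
    intro i
    by_cases hi : i < k
    · obtain ⟨e, he⟩ := exists_factor hq (lt_of_lt_of_le hi hk) hz0 hz
      exact ⟨e, fun _ => he⟩
    -- A dummy value for `i ≥ k`, so that the cofactors can be chosen for all `i` at once.
    · exact ⟨0, fun h => absurd h hi⟩
  choose e he using H
  refine ⟨∏ i ∈ Finset.range k, e i, ?_, ?_, ?_⟩
  · rw [Nat.count_eq_card_filter_range, Finset.card_filter, ← Finset.prod_pow_eq_pow_sum,
      ← Finset.prod_mul_distrib]
    exact Finset.prod_congr rfl fun i hi => (he i (Finset.mem_range.mp hi)).1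
  · rw [Polynomial.eval_prod, Finset.prod_ne_zero_iff]
    exact fun i hi => (he i (Finset.mem_range.mp hi)).2.1
  · intro hn
    rw [Polynomial.eval_prod]
    exact Finset.prod_congr rfl fun i hi => (he i (Finset.mem_range.mp hi)).2.2 hn

theorem prod_range_mul_ite {M : Type*} [CommMonoid M] {d : ℕ} (hd : 0 < d) (b : ℕ) (f h : ℕ → M) :
    (∏ i ∈ Finset.range (d * b), if d ∣ i then f i else h i) =
      (∏ e ∈ Finset.range b, f (d * e)) *
        ∏ i ∈ (Finset.range (d * b)).filter (fun i => ¬ d ∣ i), h i := by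
  rw [Finset.prod_ite]
  congr 1
  symm
  apply Finset.prod_bij (fun e _ => d * e)
  · intro e he
    simpa [hd] using he
  · intro e _ e' _ h
    exact Nat.eq_of_mul_eq_mul_left hd h
  · intro i hi
    obtain ⟨hi1, e, rfl⟩ := Finset.mem_filter.mp hi
    exact ⟨e, by simpa [hd] using hi1, rfl⟩
  · intro _ _
    rfl

open scoped Polynomial in
-- The product formula may read `0 = 0` at `z`. It is therefore used in `ℂ[X]`, with the powers of
-- `X - z` split off and cofactors that do not vanish at `z`.
theorem eval_subsetSum_factor {q d k : ℕ} {C : Finset ℕ} (hq : 1 < q) (hk : k ≤ C.card)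
    (hC : d ∣ C.card) {z : ℂ} (hz0 : z ≠ 0) (hz : HasFrobeniusPeriod q d z) :
    ∃ e₁ e₂ : ℂ[X], e₁.eval z ≠ 0 ∧ e₂.eval z ≠ 0 ∧
      subsetSum q (Polynomial.X : ℂ[X]) C k *
          ((Polynomial.X - Polynomial.C z) ^ (k.count (· ≡ k [MOD d])) * e₂) =
        (Polynomial.X - Polynomial.C z) ^ (k.count (· ≡ C.card [MOD d])) * e₁ ∧
      (e₁.eval z = ∏ i ∈ Finset.range k,
        if d ∣ i then (q : ℂ) ^ C.card - (q : ℂ) ^ i else z - z ^ q ^ i) ∧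
      (d ∣ k → e₂.eval z = ∏ i ∈ Finset.range k,
        if d ∣ i then (q : ℂ) ^ k - (q : ℂ) ^ i else z - z ^ q ^ i) := by
  obtain ⟨e₁, h1, h1', h1''⟩ := exists_prod_factor hq hk hz0 hz
  obtain ⟨e₂, h2, h2', h2''⟩ := exists_prod_factor (n := k) hq le_rfl hz0 hz
  refine ⟨e₁, e₂, h1', h2', ?_, h1'' hC, h2''⟩
  rw [← h1, ← h2]
  exact subsetSum_mul_prod q C Polynomial.X k

open scoped Polynomial in
theorem subsetSum_eq_zero {q d k : ℕ} {C : Finset ℕ} (hq : 1 < q) (hd : 0 < d) (hk : k ≤ C.card)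
    (hC : d ∣ C.card) {z : ℂ} (hz0 : z ≠ 0) (hz : HasFrobeniusPeriod q d z) (hdk : ¬ d ∣ k) :
    subsetSum q z C k = 0 := by
  obtain ⟨e₁, e₂, -, h2, h, -, -⟩ := eval_subsetSum_factor hq hk hC hz0 hz
  -- The zeros at `z` come from `i ≡ 0` in the numerator and from `i ≡ k` in the denominator. As `d
  -- ∤ k`, the class of 0 has one more member below `k`, so a simple zero survives.
  have hlt : k.count (· ≡ C.card [MOD d]) = k.count (· ≡ k [MOD d]) + 1 := by
    rw [Nat.count_modEq_card k hd, Nat.count_modEq_card k hd, Nat.mod_eq_zero_of_dvd hC,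
      if_neg (lt_irrefl _), if_pos (Nat.pos_of_ne_zero fun h => hdk (Nat.dvd_of_mod_eq_zero h))]
  rw [hlt, pow_succ] at h
  have h' : subsetSum q (Polynomial.X : ℂ[X]) C k * e₂ = (Polynomial.X - Polynomial.C z) * e₁ := by
    apply mul_left_cancel₀ (pow_ne_zero (k.count (· ≡ k [MOD d])) (Polynomial.X_sub_C_ne_zero z))
    linear_combination h
  have := congrArg (Polynomial.eval z) h'
  simp only [Polynomial.eval_mul, Polynomial.eval_sub, Polynomial.eval_X, Polynomial.eval_C,
    sub_self, zero_mul] at this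
  have hm := map_subsetSum (Polynomial.evalRingHom z) q Polynomial.X C k
  rw [Polynomial.coe_evalRingHom, Polynomial.eval_X] at hm
  rw [← hm]
  exact (mul_eq_zero.mp this).resolve_right h2

open scoped Polynomial in
theorem subsetSum_mul_prod_of_dvd {q d a b : ℕ} {C : Finset ℕ} (hq : 1 < q) (hd : 0 < d)
    (hb : b ≤ a) (hC : C.card = d * a) {z : ℂ} (hz0 : z ≠ 0) (hz : HasFrobeniusPeriod q d z) :
    subsetSum q z C (d * b) * ∏ e ∈ Finset.range b, (((q : ℂ) ^ d) ^ b - ((q : ℂ) ^ d) ^ e) =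
      ∏ e ∈ Finset.range b, (((q : ℂ) ^ d) ^ a - ((q : ℂ) ^ d) ^ e) := by
  obtain ⟨e₁, e₂, -, h2, h, hh1, hh2⟩ := eval_subsetSum_factor (d := d) (k := d * b) hq
    (by rw [hC]; exact Nat.mul_le_mul_left d hb) (by rw [hC]; exact dvd_mul_right _ _) hz0 hz
  have hlt : (d * b).count (· ≡ C.card [MOD d]) = (d * b).count (· ≡ d * b [MOD d]) := by
    rw [Nat.count_modEq_card _ hd, Nat.count_modEq_card _ hd, hC]
    simp
  rw [hlt] at h
  have h' : subsetSum q (Polynomial.X : ℂ[X]) C (d * b) * e₂ = e₁ := by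
    apply mul_left_cancel₀
      (pow_ne_zero ((d * b).count (· ≡ d * b [MOD d])) (Polynomial.X_sub_C_ne_zero z))
    linear_combination h
  have := congrArg (Polynomial.eval z) h'
  rw [Polynomial.eval_mul, hh1] at this
  -- The factors `z - z^{q^i}` with `d ∤ i` are the same in numerator and denominator and cancel.
  -- Those with `i = d e` form the Gaussian binomial.
  rw [hh2 (dvd_mul_right _ _)] at h2 this
  rw [prod_range_mul_ite hd b] at h2
  rw [prod_range_mul_ite hd b, prod_range_mul_ite hd b] at this
  have hm := map_subsetSum (Polynomial.evalRingHom z) q Polynomial.X C (d * b)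
  rw [Polynomial.coe_evalRingHom, Polynomial.eval_X] at hm
  rw [hm, ← mul_assoc] at this
  have := mul_right_cancel₀ (right_ne_zero_of_mul h2) this
  simpa only [hC, pow_mul] using this

/-! ### The off-diagonal boxes at roots of unity -/

/-- The weight of a full `β × m` box, with variables `a` for the rows and `b` for the columns. -/
def boxWeight {R : Type*} [CommRing R] (q : ℕ) (a b : R) (β m : ℕ) : R :=
  ∏ j ∈ Finset.range β, ∏ i ∈ Finset.range m, qNumber q (a ^ q ^ (i + j)) (b ^ q ^ (i + β))

theorem qNumber_self {R : Type*} [CommRing R] {q : ℕ} (a : R) :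
    qNumber q a a = q * a ^ (q - 1) := by
  unfold qNumber
  rw [Finset.sum_congr rfl (g := fun _ => a ^ (q - 1))]
  · simp
  · intro i hi
    rw [← pow_add]
    congr 1
    have := Finset.mem_range.mp hi
    omega

theorem prod_qNumber_of_eq {q : ℕ} (hq : 0 < q) {a b : ℂ} (ha : a ≠ 0) (h : a = b) {m : ℕ}
    (hm : a ^ q ^ m = a) :
    ∏ i ∈ Finset.range m, qNumber q (a ^ q ^ i) (b ^ q ^ i) = (q : ℂ) ^ m := by
  subst h
  -- The extra factor `a` turns the exponents `q^i (q - 1)` into a telescoping sum.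
  have key : ∀ m, (∏ i ∈ Finset.range m, qNumber q (a ^ q ^ i) (a ^ q ^ i)) * a =
      (q : ℂ) ^ m * a ^ q ^ m := by
    intro m
    induction m with
    | zero => simp
    | succ m ih =>
      rw [Finset.prod_range_succ, mul_right_comm, ih, qNumber_self, pow_succ q, pow_mul]
      obtain ⟨r, rfl⟩ : ∃ r, q = r + 1 := ⟨q - 1, by omega⟩
      rw [Nat.add_sub_cancel]
      push_cast
      ring
  have := key m
  rw [hm] at this
  exact mul_right_cancel₀ ha this

theorem prod_qNumber_of_ne {q : ℕ} {a b : ℂ}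
    (h : ∀ i, a ^ q ^ i ≠ b ^ q ^ i) (m : ℕ) :
    ∏ i ∈ Finset.range m, qNumber q (a ^ q ^ i) (b ^ q ^ i) =
      (a ^ q ^ m - b ^ q ^ m) / (a - b) := by
  have hab : a - b ≠ 0 := by simpa [sub_eq_zero] using h 0
  rw [eq_div_iff hab]
  induction m with
  | zero => simp
  | succ m ih =>
    rw [Finset.prod_range_succ, mul_right_comm, ih, mul_comm, qNumber_mul_sub, ← pow_mul,
      ← pow_mul, ← pow_succ]

theorem prod_range_add_of_periodic {M : Type*} [CommMonoid M] {f : ℕ → M} {β : ℕ}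
    (hf : Function.Periodic f β) (m : ℕ) :
    ∏ j ∈ Finset.range β, f (j + m) = ∏ j ∈ Finset.range β, f j := by
  induction m with
  | zero => rfl
  | succ m ih =>
    rw [← ih]
    rcases β with _ | β
    · rfl
    · rw [Finset.prod_range_succ, Finset.prod_range_succ' (fun j => f (j + m))]
      congr 1
      · exact Finset.prod_congr rfl fun j _ => by rw [add_right_comm, add_assoc]
      · rw [zero_add, ← hf m]
        congr 1
        omega

/-- Each row telescopes to a quotient whose numerator is its denominator with `j` replaced by `j +
m`. A single row need not give 1, but the shift by `m` permutes the rows cyclically because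
`a^{q^j}` has period `β` in `j`. -/
theorem boxWeight_of_ne {q d d' β m : ℕ} {a b : ℂ}
    (ha : HasFrobeniusPeriod q d a) (hb : HasFrobeniusPeriod q d' b) (hβ : d ∣ β) (hm : d' ∣ m)
    (hab : ∀ i j, a ^ q ^ i ≠ b ^ q ^ j) :
    boxWeight q a b β m = 1 := by
  have h1 : boxWeight q a b β m = ∏ j ∈ Finset.range β,
      ((a ^ q ^ (j + m) - b ^ q ^ β) / (a ^ q ^ j - b ^ q ^ β)) := by
    unfold boxWeight
    apply Finset.prod_congr rfl
    intro j _
    have := prod_qNumber_of_ne (q := q) (a := a ^ q ^ j) (b := b ^ q ^ β)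
      (fun i => by rw [← pow_mul, ← pow_mul, ← pow_add, ← pow_add]; exact hab _ _) m
    simp only [← pow_mul, ← pow_add] at this
    rw [(hb (β + m) β).mpr] at this
    · rw [← this]
      simp only [add_comm]
    · simpa using (Nat.modEq_zero_iff_dvd.mpr hm).add_left β
  rw [h1, Finset.prod_div_distrib, div_eq_one_iff_eq]
  · apply prod_range_add_of_periodic (f := fun j => a ^ q ^ j - b ^ q ^ β)
    intro j
    change a ^ q ^ (j + β) - _ = _
    rw [(ha (j + β) j).mpr]
    simpa using (Nat.modEq_zero_iff_dvd.mpr hβ).add_left j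
  · rw [Finset.prod_ne_zero_iff]
    exact fun j _ => sub_ne_zero.mpr (hab _ _)

/-- Here each row can be evaluated by itself. A row with `j ≡ c` has equal arguments in every
`q`-number and gives `q^m`; any other row telescopes to 1, since `d ∣ m`. There are `b'` rows of the
first kind. -/
theorem boxWeight_of_conj {q d b' m : ℕ} (hq : 0 < q) (hd : 0 < d) {a b : ℂ} (ha0 : a ≠ 0)
    (ha : HasFrobeniusPeriod q d a) (hb : HasFrobeniusPeriod q d b) (hm : d ∣ m) {c : ℕ}
    (hc : b = a ^ q ^ c) :
    boxWeight q a b (d * b') m = (q : ℂ) ^ (m * b') := by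
  have h1 : boxWeight q a b (d * b') m = ∏ j ∈ Finset.range (d * b'),
      if j ≡ c [MOD d] then (q : ℂ) ^ m else 1 := by
    unfold boxWeight
    apply Finset.prod_congr rfl
    intro j _
    have hbβ : ∀ i, b ^ q ^ (i + d * b') = (a ^ q ^ c) ^ q ^ i := by
      intro i
      rw [← hc, (hb (i + d * b') i).mpr]
      simp
    have haj : ∀ i, a ^ q ^ (i + j) = (a ^ q ^ j) ^ q ^ i := by
      intro i
      rw [← pow_mul, ← pow_add, add_comm]
    have hper : ∀ l, (a ^ q ^ l) ^ q ^ m = a ^ q ^ l := by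
      intro l
      rw [← pow_mul, ← pow_add, (ha (l + m) l).mpr]
      simpa using (Nat.modEq_zero_iff_dvd.mpr hm).add_left l
    simp only [hbβ, haj]
    split_ifs with h
    · exact prod_qNumber_of_eq hq (pow_ne_zero _ ha0) ((ha j c).mpr h) (hper j)
    · have hne : ∀ i, (a ^ q ^ j) ^ q ^ i ≠ (a ^ q ^ c) ^ q ^ i := by
        intro i
        rw [← pow_mul, ← pow_add, ← pow_mul, ← pow_add, Ne, ha (j + i) (c + i)]
        exact fun h' => h (Nat.ModEq.add_right_cancel' i h')
      rw [prod_qNumber_of_ne hne, hper, hper, div_self]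
      exact sub_ne_zero.mpr (by simpa using hne 0)
  rw [h1, Finset.prod_ite, Finset.prod_const_one, mul_one, Finset.prod_const,
    ← Nat.count_eq_card_filter_range, Nat.count_modEq_card _ hd, ← pow_mul]
  simp [hd]

/-! ### Blocks of columns -/

theorem blockCols_end {ℓ : ℕ} (α : Fin ℓ → ℕ) (s : Fin ℓ) :
    ∑ s' ∈ Finset.Ioi s, α s' + α s = ∑ s' ∈ Finset.Ici s, α s' := by
  rw [← Finset.Ioi_insert s, Finset.sum_insert (by simp), add_comm]

theorem lt_of_mem_blockCols {ℓ : ℕ} {α : Fin ℓ → ℕ} {r s : Fin ℓ} (h : r < s) {c p : ℕ}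
    (hc : c ∈ blockCols α s) (hp : p ∈ blockCols α r) : c < p := by
  simp only [blockCols, Finset.mem_Ico] at hc hp
  have : ∑ s' ∈ Finset.Ici s, α s' ≤ ∑ s' ∈ Finset.Ioi r, α s' := by
    apply Finset.sum_le_sum_of_subset
    intro x hx
    exact Finset.mem_Ioi.mpr (lt_of_lt_of_le h (Finset.mem_Ici.mp hx))
  rw [blockCols_end] at hc
  omega

theorem blockCols_disjoint {ℓ : ℕ} (α : Fin ℓ → ℕ) {r s : Fin ℓ} (h : r ≠ s) :
    Disjoint (blockCols α r) (blockCols α s) := by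
  rw [Finset.disjoint_left]
  intro c hr hs
  rcases lt_or_gt_of_ne h with h | h
  · exact lt_irrefl _ (lt_of_mem_blockCols h hs hr)
  · exact lt_irrefl _ (lt_of_mem_blockCols h hr hs)

theorem card_blockCols {ℓ : ℕ} (α : Fin ℓ → ℕ) (r : Fin ℓ) : (blockCols α r).card = α r := by
  simp [blockCols]

theorem biUnion_blockCols {ℓ : ℕ} (α : Fin ℓ → ℕ) :
    Finset.univ.biUnion (blockCols α) = Finset.range (∑ r, α r) := by
  apply Finset.eq_of_subset_of_card_le
  · intro c hc
    obtain ⟨s, -, hs⟩ := Finset.mem_biUnion.mp hc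
    simp only [blockCols, Finset.mem_Ico] at hs
    rw [blockCols_end] at hs
    have : ∑ s' ∈ Finset.Ici s, α s' ≤ ∑ s', α s' :=
      Finset.sum_le_sum_of_subset (Finset.subset_univ _)
    rw [Finset.mem_range]
    omega
  · rw [Finset.card_biUnion fun r _ s _ h => blockCols_disjoint α h]
    simp [card_blockCols]

/-! ### The weight in terms of the set of pivot columns -/

/-- The set of pivot columns. -/
def pivotSet {k : ℕ} (lam : Fin k → ℕ) : Finset ℕ := Finset.univ.image (pivot lam)

theorem pivot_strictAnti {k : ℕ} {lam : Fin k → ℕ} (h : Antitone lam) : StrictAnti (pivot lam) := by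
  intro i j hij
  have h1 := h hij.le
  have h2 : (i : ℕ) < j := hij
  have := j.2
  unfold pivot
  omega

theorem image_blockRows {ℓ k : ℕ} (α : Fin ℓ → ℕ) (lam : Fin k → ℕ) (r : Fin ℓ) :
    (blockRows α lam r).image (pivot lam) = pivotSet lam ∩ blockCols α r := by
  ext c
  simp only [blockRows, pivotSet, Finset.mem_image, Finset.mem_filter, Finset.mem_univ, true_and,
    Finset.mem_inter]
  constructor
  · rintro ⟨i, hi, rfl⟩
    exact ⟨⟨i, rfl⟩, hi⟩
  · rintro ⟨⟨i, rfl⟩, hi⟩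
    exact ⟨i, hi, rfl⟩

theorem beta_eq_card {ℓ k : ℕ} (α : Fin ℓ → ℕ) {lam : Fin k → ℕ} (h : Antitone lam) (r : Fin ℓ) :
    beta α lam r = (pivotSet lam ∩ blockCols α r).card := by
  rw [← image_blockRows, Finset.card_image_of_injective _ (pivot_strictAnti h).injective, beta]

theorem freeCols_eq {ℓ k : ℕ} (α : Fin ℓ → ℕ) (lam : Fin k → ℕ) (s : Fin ℓ) :
    freeCols α lam s = blockCols α s \ (pivotSet lam ∩ blockCols α s) := by
  ext c
  simp only [freeCols, pivotSet, Finset.mem_filter, Finset.mem_sdiff, Finset.mem_inter,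
    Finset.mem_image, Finset.mem_univ, true_and, not_and]
  constructor
  · rintro ⟨h1, h2⟩
    exact ⟨h1, fun ⟨i, hi⟩ => absurd hi (h2 i)⟩
  · rintro ⟨h1, h2⟩
    exact ⟨h1, fun i hi => h2 ⟨i, hi⟩ h1⟩

theorem vdist_eq {ℓ k : ℕ} (α : Fin ℓ → ℕ) {lam : Fin k → ℕ} (h : Antitone lam) (r : Fin ℓ)
    (x : Fin k × ℕ) :
    vdist α lam r x =
      ((pivotSet lam ∩ blockCols α r).filter (fun p => p < pivot lam x.1)).card := by
  rw [← image_blockRows, Finset.filter_image,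
    Finset.card_image_of_injective _ (pivot_strictAnti h).injective, vdist]
  congr 1
  apply Finset.filter_congr
  intro i _
  exact (pivot_strictAnti h).lt_iff_gt.symm

theorem blockWeight_eq {ℓ k : ℕ} (q : ℕ) (α : Fin ℓ → ℕ) {lam : Fin k → ℕ} (h : Antitone lam)
    (r s : Fin ℓ) {S T : Finset ℕ} (hS : pivotSet lam ∩ blockCols α r = S)
    (hT : pivotSet lam ∩ blockCols α s = T) :
    blockWeight q α lam r s =
      ∏ p ∈ S, ∏ c ∈ (blockCols α s \ T).filter (fun c => c < p),
        qNumber q ((X r : MvPolynomial (Fin ℓ) ℤ) ^ q ^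
            (((blockCols α s \ T).filter (fun x => x < c)).card +
              (S.filter (fun x => x < p)).card))
          ((X s : MvPolynomial (Fin ℓ) ℤ) ^ q ^
            (((blockCols α s \ T).filter (fun x => x < c)).card + S.card)) := by
  unfold blockWeight cells
  simp only [vdist_eq α h, beta_eq_card α h, hdist, freeCols_eq, hS, hT]
  rw [Finset.prod_filter, Finset.prod_product, ← hS, ← image_blockRows,
    Finset.prod_image (pivot_strictAnti h).injective.injOn]
  exact Finset.prod_congr rfl fun i _ => (Finset.prod_filter _ _).symm

/-- The weight of the family `S` of sets of pivot columns. -/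
def familyWeight {ℓ : ℕ} (q : ℕ) (α : Fin ℓ → ℕ) (S : Fin ℓ → Finset ℕ) :
    MvPolynomial (Fin ℓ) ℤ :=
  (∏ r, subsetWeight q (X r) (blockCols α r) (S r)) *
    ∏ r, ∏ s ∈ Finset.Ioi r, boxWeight q (X r) (X s) (S r).card (α s - (S s).card)

theorem weight_eq {ℓ k : ℕ} (q : ℕ) (α : Fin ℓ → ℕ) {lam : Fin k → ℕ} (h : Antitone lam) :
    weight q α lam = familyWeight q α (fun r => pivotSet lam ∩ blockCols α r) := by
  unfold weight familyWeight
  rw [← Finset.prod_mul_distrib]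
  apply Finset.prod_congr rfl
  intro r _
  rw [← Finset.Ioi_insert r, Finset.prod_insert (by simp)]
  congr 1
  · exact blockWeight_eq q α h r r rfl rfl
  · apply Finset.prod_congr rfl
    intro s hs
    rw [Finset.mem_Ioi] at hs
    rw [blockWeight_eq q α h r s rfl rfl]
    set S := pivotSet lam ∩ blockCols α r
    set T := pivotSet lam ∩ blockCols α s
    have hcard : (blockCols α s \ T).card = α s - T.card := by
      rw [Finset.card_sdiff_of_subset Finset.inter_subset_right, card_blockCols]
    unfold boxWeight
    rw [← prod_rank S (fun j => ∏ i ∈ Finset.range (α s - T.card),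
      qNumber q (X r ^ q ^ (i + j)) (X s ^ q ^ (i + S.card)))]
    apply Finset.prod_congr rfl
    intro p hp
    -- Blocks are numbered from right to left, so for `r < s` every column of block `s` is left of
    -- every pivot of block `r`: the box is full, and ranks turn it into a product over ranges.
    rw [Finset.filter_true_of_mem, ← hcard, ← prod_rank (blockCols α s \ T) (fun i =>
      qNumber q (X r ^ q ^ (i + (S.filter (fun x => x < p)).card)) (X s ^ q ^ (i + S.card)))]
    intro c hc
    exact lt_of_mem_blockCols hs (Finset.mem_sdiff.mp hc).1 (Finset.mem_inter.mp hp).2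

/-! ### Partitions in a box and sets of pivot columns -/

theorem mem_boxPartitions {n k : ℕ} {lam : Fin k → ℕ} :
    lam ∈ boxPartitions n k ↔ (∀ i, lam i ≤ n - k) ∧ Antitone lam := by
  simp [boxPartitions]

theorem pivotSet_mem {n k : ℕ} (hk : k ≤ n) {lam : Fin k → ℕ} (h : lam ∈ boxPartitions n k) :
    pivotSet lam ∈ (Finset.range n).powersetCard k := by
  rw [mem_boxPartitions] at h
  rw [Finset.mem_powersetCard]
  constructor
  · intro c hc
    obtain ⟨i, -, rfl⟩ := Finset.mem_image.mp hc
    have := h.1 i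
    have := i.2
    rw [Finset.mem_range]
    unfold pivot
    omega
  · rw [pivotSet, Finset.card_image_of_injective _ (pivot_strictAnti h.2).injective]
    simp

theorem strictMono_add_sub_le {k : ℕ} {f : Fin k → ℕ} (hf : StrictMono f) {i j : Fin k}
    (hij : i ≤ j) : f i + (j - i : ℕ) ≤ f j := by
  obtain ⟨j, hj⟩ := j
  induction j with
  | zero =>
    have : i = ⟨0, hj⟩ := le_antisymm hij (Fin.mk_le_of_le_val (Nat.zero_le _))
    simp [this]
  | succ j ih =>
    rcases hij.eq_or_lt with rfl | hlt
    · simp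
    · have h1 : (i : ℕ) < j + 1 := hlt
      have h2 := ih (by omega) (by rw [Fin.le_def]; simp only; omega)
      have h3 : f ⟨j, by omega⟩ < f ⟨j + 1, hj⟩ := hf (by simp)
      simp only at h2 ⊢
      omega

theorem sum_boxPartitions {M : Type*} [AddCommMonoid M] {n k : ℕ} (hk : k ≤ n)
    (f : Finset ℕ → M) :
    ∑ lam ∈ boxPartitions n k, f (pivotSet lam) = ∑ S ∈ (Finset.range n).powersetCard k, f S := by
  apply Finset.sum_bij (fun lam _ => pivotSet lam)
  · exact fun lam h => pivotSet_mem hk h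
  · intro lam h mu h' he
    rw [mem_boxPartitions] at h h'
    have hrange : Set.range (pivot lam ∘ Fin.rev) = Set.range (pivot mu ∘ Fin.rev) := by
      rw [Fin.rev_surjective.range_comp, Fin.rev_surjective.range_comp]
      simpa [pivotSet] using congrArg (fun S : Finset ℕ => (S : Set ℕ)) he
    have h1 : StrictMono (pivot lam ∘ Fin.rev) :=
      (pivot_strictAnti h.2).comp Fin.rev_strictAnti
    have h2 : StrictMono (pivot mu ∘ Fin.rev) :=
      (pivot_strictAnti h'.2).comp Fin.rev_strictAnti
    have := (h1.range_inj h2).mp hrange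
    funext i
    have := congrFun this i.rev
    simp only [Function.comp_apply, Fin.rev_rev, pivot] at this
    omega
  · intro S hS
    rw [Finset.mem_powersetCard] at hS
    set e := S.orderEmbOfFin hS.2 with he
    have hstep : ∀ i j : Fin k, i ≤ j → e i + (j - i : ℕ) ≤ e j :=
      fun i j => strictMono_add_sub_le e.strictMono
    have hle : ∀ i : Fin k, (i : ℕ) ≤ e i := fun i => by
      have hi := i.2
      have := hstep ⟨0, by omega⟩ i (Fin.mk_le_of_le_val (Nat.zero_le _))
      simp only at this
      omega
    have hup : ∀ i : Fin k, e i + (k - i) ≤ n := fun i => by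
      have hi := i.2
      have h1 := hstep i ⟨k - 1, by omega⟩ (by rw [Fin.le_def]; simp only; omega)
      have h2 := Finset.mem_range.mp (hS.1 (S.orderEmbOfFin_mem hS.2 ⟨k - 1, by omega⟩))
      rw [← he] at h2
      simp only at h1
      omega
    -- The decreasing enumeration of `S` minus the staircase `k - 1 - i`. By `hle` the truncated
    -- subtraction is exact, and `hup` bounds the parts by `n - k`.
    refine ⟨fun i => e i.rev - (k - 1 - i), ?_, ?_⟩
    · rw [mem_boxPartitions]
      constructor
      · intro i
        have := hup i.rev
        have hi := i.2
        simp only [Fin.val_rev] at this ⊢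
        omega
      · intro i j hij
        have := hstep j.rev i.rev (Fin.rev_le_rev.mpr hij)
        have hi := i.2
        have hj := j.2
        have : (i : ℕ) ≤ j := hij
        simp only [Fin.val_rev] at *
        omega
    · have : pivot (fun i : Fin k => e i.rev - (k - 1 - i)) = e ∘ Fin.rev := by
        funext i
        have := hle i.rev
        have hi := i.2
        simp only [Fin.val_rev, pivot, Function.comp_apply] at *
        omega
      apply Finset.coe_injective
      rw [pivotSet, this, Finset.coe_image, Finset.coe_univ, Set.image_univ,
        Fin.rev_surjective.range_comp]
      exact Finset.range_orderEmbOfFin S hS.2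
  · intro _ _
    rfl

theorem sum_powersetCard_range {M : Type*} [AddCommMonoid M] {ℓ : ℕ} (α : Fin ℓ → ℕ) (k : ℕ)
    (f : (Fin ℓ → Finset ℕ) → M) :
    ∑ S ∈ (Finset.range (∑ r, α r)).powersetCard k, f (fun r => S ∩ blockCols α r) =
      ∑ T ∈ (Fintype.piFinset fun r => (blockCols α r).powerset).filter
        (fun T => ∑ r, (T r).card = k), f T := by
  have hinter : ∀ S ⊆ Finset.range (∑ r, α r),
      Finset.univ.biUnion (fun r => S ∩ blockCols α r) = S := by
    intro S hS
    rw [← Finset.inter_biUnion, biUnion_blockCols, Finset.inter_eq_left.mpr hS]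
  have hdisj : ∀ T : Fin ℓ → Finset ℕ, (∀ r, T r ⊆ blockCols α r) →
      (Finset.univ.biUnion T).card = ∑ r, (T r).card := by
    intro T hT
    rw [Finset.card_biUnion]
    exact fun r _ s _ h =>
      Finset.disjoint_of_subset_left (hT r) (Finset.disjoint_of_subset_right (hT s)
        (blockCols_disjoint α h))
  apply Finset.sum_bij (fun S _ r => S ∩ blockCols α r)
  · intro S hS
    rw [Finset.mem_powersetCard] at hS
    simp only [Finset.mem_filter, Fintype.mem_piFinset, Finset.mem_powerset]
    refine ⟨fun r => Finset.inter_subset_right, ?_⟩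
    rw [← hdisj _ (fun r => Finset.inter_subset_right), hinter S hS.1, hS.2]
  · intro S hS S' hS' h
    rw [Finset.mem_powersetCard] at hS hS'
    rw [← hinter S hS.1, ← hinter S' hS'.1, h]
  · intro T hT
    simp only [Finset.mem_filter, Fintype.mem_piFinset, Finset.mem_powerset] at hT
    refine ⟨Finset.univ.biUnion T, ?_, ?_⟩
    · rw [Finset.mem_powersetCard, hdisj T hT.1]
      refine ⟨?_, hT.2⟩
      rw [← biUnion_blockCols]
      exact Finset.biUnion_mono fun r _ => hT.1 r
    · funext r
      ext c
      simp only [Finset.mem_inter, Finset.mem_biUnion, Finset.mem_univ, true_and]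
      constructor
      · rintro ⟨⟨s, hs⟩, hc⟩
        by_cases hrs : s = r
        · exact hrs ▸ hs
        · exact absurd hc (Finset.disjoint_left.mp (blockCols_disjoint α hrs) (hT.1 s hs))
      · exact fun hc => ⟨⟨r, hc⟩, hT.1 r hc⟩
  · intro _ _
    rfl

/-- The sieving polynomial as a sum over the numbers of pivots in the blocks. -/
theorem sievingPolynomial_eq {ℓ : ℕ} (q n k : ℕ) (hk : k ≤ n) (α : Fin ℓ → ℕ)
    (hn : ∑ r, α r = n) :
    sievingPolynomial q n k α =
      ∑ β ∈ (Fintype.piFinset fun r => Finset.range (α r + 1)).filter (fun β => ∑ r, β r = k),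
        (∏ r, subsetSum q (X r : MvPolynomial (Fin ℓ) ℤ) (blockCols α r) (β r)) *
          ∏ r, ∏ s ∈ Finset.Ioi r, boxWeight q (X r) (X s) (β r) (α s - β s) := by
  subst hn
  unfold sievingPolynomial
  rw [Finset.sum_congr rfl fun lam h => weight_eq q α (mem_boxPartitions.mp h).2,
    sum_boxPartitions hk (fun S => familyWeight q α (fun r => S ∩ blockCols α r)),
    sum_powersetCard_range]
  -- The off-diagonal factors depend only on the numbers of pivots in the blocks. On a fibre with
  -- these numbers fixed, the diagonal factors can be summed independently.
  rw [← Finset.sum_fiberwise_of_maps_to (t := (Fintype.piFinset fun r =>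
    Finset.range (α r + 1)).filter (fun β => ∑ r, β r = k)) (g := fun T r => (T r).card)]
  · apply Finset.sum_congr rfl
    intro β hβ
    rw [Finset.mem_filter] at hβ
    have hset : ((Fintype.piFinset fun r => (blockCols α r).powerset).filter
        (fun T => ∑ r, (T r).card = k)).filter (fun T => (fun r => (T r).card) = β) =
        Fintype.piFinset fun r => (blockCols α r).powersetCard (β r) := by
      ext T
      simp only [Finset.mem_filter, Fintype.mem_piFinset, Finset.mem_powerset,
        Finset.mem_powersetCard]
      constructor
      · rintro ⟨⟨h1, h2⟩, h3⟩
        exact fun r => ⟨h1 r, congrFun h3 r⟩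
      · intro h
        refine ⟨⟨fun r => (h r).1, ?_⟩, funext fun r => (h r).2⟩
        rw [← hβ.2]
        exact Finset.sum_congr rfl fun r _ => (h r).2
    rw [hset]
    unfold subsetSum
    rw [Finset.prod_univ_sum, Finset.sum_mul]
    apply Finset.sum_congr rfl
    intro T hT
    rw [Fintype.mem_piFinset] at hT
    unfold familyWeight
    refine congrArg₂ (· * ·) rfl ?_
    apply Finset.prod_congr rfl
    intro r _
    apply Finset.prod_congr rfl
    intro s _
    rw [(Finset.mem_powersetCard.mp (hT r)).2, (Finset.mem_powersetCard.mp (hT s)).2]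
  · intro T hT
    simp only [Finset.mem_filter, Fintype.mem_piFinset, Finset.mem_powerset, Finset.mem_range] at *
    refine ⟨fun r => ?_, hT.2⟩
    have := Finset.card_le_card (hT.1 r)
    rw [card_blockCols] at this
    omega

/-! ### Numbers of homomorphisms between finite semisimple modules -/

section HomCard

variable {R : Type*} [CommRing R]

/-- The number of `R`-linear maps from `P` to `M`. -/
def homCard (R : Type*) [CommRing R] (P M : Type*) [AddCommGroup P] [Module R P] [AddCommGroup M]
    [Module R M] : ℕ := Nat.card (P →ₗ[R] M)

variable {P P' M M' N Q : Type*} [AddCommGroup P] [Module R P] [AddCommGroup P'] [Module R P']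
  [AddCommGroup M] [Module R M] [AddCommGroup M'] [Module R M'] [AddCommGroup N] [Module R N]
  [AddCommGroup Q] [Module R Q]

theorem finite_quotient [Finite M] (W : Submodule R M) : Finite (M ⧸ W) :=
  Finite.of_surjective _ W.mkQ_surjective

theorem homCard_pos [Finite P] [Finite M] : 0 < homCard R P M := by
  have : Finite (P →ₗ[R] M) := DFunLike.finite _
  exact Nat.card_pos

theorem homCard_congr_right (e : M ≃ₗ[R] M') : homCard R P M = homCard R P M' :=
  Nat.card_congr (LinearEquiv.congrRight e).toEquiv

theorem homCard_congr_left (e : P ≃ₗ[R] P') : homCard R P M = homCard R P' M :=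
  Nat.card_congr (LinearEquiv.congrLeft M R e).toEquiv

theorem homCard_prod_right : homCard R P (M × N) = homCard R P M * homCard R P N := by
  rw [homCard, ← Nat.card_congr (LinearMap.prodEquiv R).toEquiv, Nat.card_prod]
  rfl

theorem homCard_prod_left : homCard R (P × P') M = homCard R P M * homCard R P' M := by
  rw [homCard, ← Nat.card_congr (LinearMap.coprodEquiv R).toEquiv, Nat.card_prod]
  rfl

theorem homCard_pi_right (ι : Type*) [Fintype ι] :
    homCard R P (ι → M) = homCard R P M ^ Fintype.card ι := by
  have e : (P →ₗ[R] (ι → M)) ≃ (ι → (P →ₗ[R] M)) :=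
    { toFun := fun f i => (LinearMap.proj i).comp f
      invFun := LinearMap.pi
      left_inv := fun _ => rfl
      right_inv := fun _ => rfl }
  rw [homCard, Nat.card_congr e, Nat.card_fun, Nat.card_eq_fintype_card (α := ι)]
  rfl

theorem homCard_pi_left (ι : Type*) [Fintype ι] :
    homCard R (ι → P) M = homCard R P M ^ Fintype.card ι := by
  classical
  rw [homCard, ← Nat.card_congr (LinearMap.lsum R (fun _ : ι => P) R).toEquiv, Nat.card_fun,
    Nat.card_eq_fintype_card (α := ι)]
  rfl

/-- Over a semisimple ring the kernel has a complement, which is isomorphic to the range. -/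
theorem homCard_ker_range [IsSemisimpleRing R] (f : M →ₗ[R] N) :
    homCard R P M = homCard R P (LinearMap.ker f) * homCard R P (LinearMap.range f) := by
  obtain ⟨K, hK⟩ := exists_isCompl (LinearMap.ker f)
  rw [← homCard_congr_right f.quotKerEquivRange,
    homCard_congr_right (Submodule.quotientEquivOfIsCompl _ _ hK), ← homCard_prod_right]
  exact homCard_congr_right (Submodule.prodEquivOfIsCompl _ _ hK).symm

theorem homCard_quotient [IsSemisimpleRing R] (W : Submodule R M) :
    homCard R P M = homCard R P W * homCard R P (M ⧸ W) := by
  rw [homCard_ker_range W.mkQ, Submodule.ker_mkQ, Submodule.range_mkQ]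
  exact congrArg _ (homCard_congr_right Submodule.topEquiv)

/-- The part of a submodule of `Q × N` that lies in `N`. -/
def sndPart (W : Submodule R (Q × N)) : Submodule R N := W.comap (LinearMap.inr R Q N)

/-- The projection to `Q` of a submodule of `Q × N`. -/
def fstPart (W : Submodule R (Q × N)) : Submodule R Q := W.map (LinearMap.fst R Q N)

theorem mem_sndPart {W : Submodule R (Q × N)} {n : N} : n ∈ sndPart W ↔ ((0 : Q), n) ∈ W := Iff.rfl

theorem mem_fstPart {W : Submodule R (Q × N)} {b : Q} : b ∈ fstPart W ↔ ∃ n, (b, n) ∈ W := by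
  simp [fstPart]

/-- The kernel of the projection of `W` to `Q`. -/
def kerFstEquiv (W : Submodule R (Q × N)) :
    LinearMap.ker ((LinearMap.fst R Q N).comp W.subtype) ≃ₗ[R] sndPart W where
  toFun w := ⟨w.1.1.2, by
    have h : w.1.1.1 = 0 := w.2
    have h' := w.1.2
    rw [mem_sndPart, ← h]
    exact h'⟩
  map_add' _ _ := rfl
  map_smul' _ _ := rfl
  invFun n := ⟨⟨(0, n.1), n.2⟩, rfl⟩
  left_inv w := by
    apply Subtype.ext
    apply Subtype.ext
    have h : w.1.1.1 = 0 := w.2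
    exact Prod.ext h.symm rfl
  right_inv _ := rfl

theorem homCard_submodule_prod [IsSemisimpleRing R] (W : Submodule R (Q × N)) :
    homCard R P W = homCard R P (fstPart W) * homCard R P (sndPart W) := by
  rw [homCard_ker_range ((LinearMap.fst R Q N).comp W.subtype),
    homCard_congr_right (kerFstEquiv W), LinearMap.range_comp, Submodule.range_subtype, mul_comm]
  rfl

theorem card_submodule_prod (W : Submodule R (Q × N)) :
    Nat.card W = Nat.card (fstPart W) * Nat.card (sndPart W) := by
  rw [Submodule.card_eq_card_quotient_mul_card
    (LinearMap.ker ((LinearMap.fst R Q N).comp W.subtype)), mul_comm,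
    Nat.card_congr (kerFstEquiv W).toEquiv,
    Nat.card_congr ((LinearMap.fst R Q N).comp W.subtype).quotKerEquivRange.toEquiv,
    LinearMap.range_comp, Submodule.range_subtype]
  rfl

theorem homCard_quotient_prod [IsSemisimpleRing R] [Finite P] [Finite Q] [Finite N]
    (W : Submodule R (Q × N)) :
    homCard R P ((Q × N) ⧸ W) =
      homCard R P (Q ⧸ fstPart W) * homCard R P (N ⧸ sndPart W) := by
  -- The quotients are compared through Hom counts alone: both products complete the same positive
  -- number to the count for `Q × N`.
  have h1 := homCard_quotient (P := P) W
  rw [homCard_prod_right, homCard_quotient (fstPart W), homCard_quotient (sndPart W),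
    homCard_submodule_prod] at h1
  have h2 : 0 < homCard R P (fstPart W) * homCard R P (sndPart W) :=
    Nat.mul_pos homCard_pos homCard_pos
  apply Nat.eq_of_mul_eq_mul_left h2
  rw [← h1]
  ring

/-- The submodule of `Q × N` given by a homomorphism `B → N ⧸ A`. -/
def glue {A : Submodule R N} {B : Submodule R Q} (φ : B →ₗ[R] N ⧸ A) : Submodule R (Q × N) where
  carrier := {x | ∃ hb : x.1 ∈ B, φ ⟨x.1, hb⟩ = A.mkQ x.2}
  add_mem' := by
    rintro x y ⟨hx, hx'⟩ ⟨hy, hy'⟩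
    refine ⟨B.add_mem hx hy, ?_⟩
    rw [Prod.snd_add, map_add, ← hx', ← hy', ← map_add]
    rfl
  zero_mem' := ⟨B.zero_mem, by
    rw [Prod.snd_zero, map_zero]
    exact map_zero φ⟩
  smul_mem' := by
    rintro c x ⟨hx, hx'⟩
    refine ⟨B.smul_mem c hx, ?_⟩
    rw [Prod.smul_snd, map_smul, ← hx', ← map_smul]
    rfl

theorem sndPart_glue {A : Submodule R N} {B : Submodule R Q} (φ : B →ₗ[R] N ⧸ A) :
    sndPart (glue φ) = A := by
  ext n
  rw [mem_sndPart]
  constructor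
  · rintro ⟨h0, h⟩
    have : φ ⟨0, h0⟩ = 0 := map_zero φ
    exact (Submodule.Quotient.mk_eq_zero A).mp (h.symm.trans this)
  · intro hn
    refine ⟨B.zero_mem, ?_⟩
    have : φ ⟨0, B.zero_mem⟩ = 0 := map_zero φ
    rw [this, eq_comm]
    simpa using hn

theorem fstPart_glue {A : Submodule R N} {B : Submodule R Q} (φ : B →ₗ[R] N ⧸ A) :
    fstPart (glue φ) = B := by
  ext b
  rw [mem_fstPart]
  constructor
  · rintro ⟨n, hb, -⟩
    exact hb
  · intro hb
    obtain ⟨n, hn⟩ := A.mkQ_surjective (φ ⟨b, hb⟩)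
    exact ⟨n, hb, hn.symm⟩

/-- Two lifts to `W` of the same element of `Q` differ by an element of `sndPart W`, so the second
coordinate is a well-defined linear function with values in `N ⧸ sndPart W`. -/
theorem exists_glue (W : Submodule R (Q × N)) :
    ∃ φ : fstPart W →ₗ[R] N ⧸ sndPart W, glue φ = W := by
  choose n hn using fun b : fstPart W => mem_fstPart.mp b.2
  have key : ∀ (b : fstPart W) (m : N), ((b : Q), m) ∈ W →
      (sndPart W).mkQ (n b) = (sndPart W).mkQ m := by
    intro b m hm
    rw [← sub_eq_zero, ← map_sub, Submodule.mkQ_apply, Submodule.Quotient.mk_eq_zero, mem_sndPart]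
    simpa using W.sub_mem (hn b) hm
  let φ : fstPart W →ₗ[R] N ⧸ sndPart W :=
    { toFun := fun b => (sndPart W).mkQ (n b)
      map_add' := fun a b => by
        rw [← map_add]
        exact key _ _ (by simpa using W.add_mem (hn a) (hn b))
      map_smul' := fun c b => by
        rw [RingHom.id_apply, ← map_smul]
        exact key _ _ (by simpa using W.smul_mem c (hn b)) }
  refine ⟨φ, ?_⟩
  ext ⟨b, m⟩
  constructor
  · rintro ⟨hb, h⟩
    have h' : (sndPart W).mkQ (n ⟨b, hb⟩) = (sndPart W).mkQ m := h
    rw [← sub_eq_zero, ← map_sub, Submodule.mkQ_apply, Submodule.Quotient.mk_eq_zero,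
      mem_sndPart] at h'
    have := W.sub_mem (hn ⟨b, hb⟩) h'
    simpa using this
  · intro h
    have hb : b ∈ fstPart W := mem_fstPart.mpr ⟨m, h⟩
    exact ⟨hb, key ⟨b, hb⟩ m h⟩

theorem card_fiber (B : Submodule R Q) (A : Submodule R N) :
    Nat.card {W : Submodule R (Q × N) // fstPart W = B ∧ sndPart W = A} =
      homCard R B (N ⧸ A) := by
  symm
  apply Nat.card_eq_of_bijective
    (fun φ : B →ₗ[R] N ⧸ A => (⟨glue φ, fstPart_glue φ, sndPart_glue φ⟩ :
      {W : Submodule R (Q × N) // fstPart W = B ∧ sndPart W = A}))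
  constructor
  · intro φ ψ h
    have h' : glue φ = glue ψ := congrArg Subtype.val h
    ext b
    obtain ⟨n, hn⟩ := A.mkQ_surjective (φ b)
    have h1 : ((b : Q), n) ∈ glue φ := ⟨b.2, hn.symm⟩
    rw [h'] at h1
    obtain ⟨_, h2⟩ := h1
    rw [← hn]
    exact h2.symm
  · rintro ⟨W, rfl, rfl⟩
    obtain ⟨φ, hφ⟩ := exists_glue W
    exact ⟨φ, Subtype.ext hφ⟩

theorem finsum_submodule_prod [Finite Q] [Finite N]
    (G : Submodule R Q → Submodule R N → ℂ) :
    ∑ᶠ W : Submodule R (Q × N), G (fstPart W) (sndPart W) =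
      ∑ᶠ B : Submodule R Q, ∑ᶠ A : Submodule R N, (homCard R B (N ⧸ A) : ℂ) * G B A := by
  classical
  have := Fintype.ofFinite (Submodule R Q)
  have := Fintype.ofFinite (Submodule R N)
  have := Fintype.ofFinite (Submodule R (Q × N))
  simp only [finsum_eq_sum_of_fintype]
  rw [← Finset.sum_fiberwise _ (fun W => (fstPart W, sndPart W)), Fintype.sum_prod_type]
  apply Finset.sum_congr rfl
  intro B _
  apply Finset.sum_congr rfl
  intro A _
  rw [← card_fiber, Nat.card_eq_fintype_card, Fintype.card_subtype, ← nsmul_eq_mul,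
    ← Finset.sum_const]
  simp only [Prod.mk.injEq]
  apply Finset.sum_congr rfl
  intro W hW
  rw [(Finset.mem_filter.mp hW).2.1, (Finset.mem_filter.mp hW).2.2]

/-- A finite module that is annihilated by a maximal ideal `I` is a power of `R ⧸ I`. -/
theorem nonempty_linearEquiv_pi [Finite M] {I : Ideal R} [hI : I.IsMaximal] [Finite (R ⧸ I)]
    (hM : ∀ x ∈ I, ∀ m : M, x • m = 0) :
    ∃ b, Nat.card M = Nat.card (R ⧸ I) ^ b ∧ Nonempty (M ≃ₗ[R] (Fin b → R ⧸ I)) := by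
  have ht : Module.IsTorsionBySet R M I := fun m x => hM x x.2 m
  let : Field (R ⧸ I) := Ideal.Quotient.field I
  let : Module (R ⧸ I) M := ht.module
  have : IsScalarTower R (R ⧸ I) M := ht.isScalarTower
  refine ⟨Module.finrank (R ⧸ I) M, Module.natCard_eq_pow_finrank, ⟨?_⟩⟩
  exact (Module.finBasis (R ⧸ I) M).equivFun.restrictScalars R

theorem nonempty_linearEquiv_pi_of_card [Finite M] {I : Ideal R} [hI : I.IsMaximal]
    [Finite (R ⧸ I)] (hM : ∀ x ∈ I, ∀ m : M, x • m = 0) {b : ℕ}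
    (hb : Nat.card M = Nat.card (R ⧸ I) ^ b) : Nonempty (M ≃ₗ[R] (Fin b → R ⧸ I)) := by
  obtain ⟨c, hc, he⟩ := nonempty_linearEquiv_pi hM
  let : Field (R ⧸ I) := Ideal.Quotient.field I
  have : c = b := Nat.pow_right_injective (Finite.one_lt_card (α := R ⧸ I)) (hc.symm.trans hb)
  exact this ▸ he

end HomCard

/-! ### The number of subspaces of a vector space over a finite field -/

section Gaussian

/-- Linearly independent `b`-tuples of `V` are counted directly, and again according to the
`b`-dimensional subspace that they span. -/
theorem card_subspaces_mul {K V : Type*} [Field K] [Finite K] [AddCommGroup V] [Module K V]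
    [Finite V] {b : ℕ} (hb : b ≤ Module.finrank K V) :
    (Nat.card {W : Submodule K V // Nat.card W = Nat.card K ^ b} : ℂ) *
        ∏ e ∈ Finset.range b, ((Nat.card K : ℂ) ^ b - (Nat.card K : ℂ) ^ e) =
      ∏ e ∈ Finset.range b, ((Nat.card K : ℂ) ^ Module.finrank K V - (Nat.card K : ℂ) ^ e) := by
  classical
  have := Fintype.ofFinite K
  have hcast : ∀ {U : Type _} [AddCommGroup U] [Module K U] [Finite U],
      b ≤ Module.finrank K U → (Nat.card {s : Fin b → U // LinearIndependent K s} : ℂ) =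
        ∏ e ∈ Finset.range b, ((Nat.card K : ℂ) ^ Module.finrank K U - (Nat.card K : ℂ) ^ e) := by
    intro U _ _ _ hU
    rw [card_linearIndependent hU, Nat.cast_prod, Finset.prod_range]
    apply Finset.prod_congr rfl
    intro e _
    rw [Nat.cast_sub (Nat.pow_le_pow_right Fintype.card_pos (e.2.le.trans hU)),
      Nat.card_eq_fintype_card]
    push_cast
    rfl
  have hfin : ∀ W : {W : Submodule K V // Nat.card W = Nat.card K ^ b},
      Module.finrank K W.1 = b := fun W =>
    Nat.pow_right_injective (Finite.one_lt_card (α := K))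
      ((Module.natCard_eq_pow_finrank (K := K) (V := W.1)).symm.trans W.2)
  have hspan : ∀ (W : Submodule K V), Nat.card W = Nat.card K ^ b → ∀ s : Fin b → W,
      LinearIndependent K s → Submodule.span K (Set.range fun i => (s i : V)) = W := by
    intro W hW s hs
    have h1 := hs.span_eq_top_of_card_eq_finrank' (by
      rw [Fintype.card_fin]
      exact (hfin ⟨W, hW⟩).symm)
    have h2 := congrArg (Submodule.map W.subtype) h1
    rw [Submodule.map_span, Submodule.map_top, Submodule.range_subtype, ← Set.range_comp] at h2
    exact h2
  let f : (Σ W : {W : Submodule K V // Nat.card W = Nat.card K ^ b},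
        {s : Fin b → W.1 // LinearIndependent K s}) →
      {s : Fin b → V // LinearIndependent K s} := fun x =>
    ⟨fun i => (x.2.1 i : V), x.2.2.map' (Submodule.subtype _) (Submodule.ker_subtype _)⟩
  have hf : Function.Bijective f := by
    constructor
    · rintro ⟨⟨W, hW⟩, ⟨s, hs⟩⟩ ⟨⟨W', hW'⟩, ⟨s', hs'⟩⟩ h
      have h' : (fun i => (s i : V)) = fun i => (s' i : V) := congrArg Subtype.val h
      obtain rfl : W = W' := by rw [← hspan W hW s hs, ← hspan W' hW' s' hs', h']
      obtain rfl : s = s' := funext fun i => Subtype.ext (congrFun h' i)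
      rfl
    · intro s
      exact ⟨⟨⟨Submodule.span K (Set.range s.1), by
          rw [Module.natCard_eq_pow_finrank (K := K), finrank_span_eq_card s.2, Fintype.card_fin]⟩,
        ⟨fun i => ⟨s.1 i, Submodule.subset_span ⟨i, rfl⟩⟩,
          LinearIndependent.of_comp (Submodule.subtype _) s.2⟩⟩, rfl⟩
  have := Fintype.ofFinite {W : Submodule K V // Nat.card W = Nat.card K ^ b}
  rw [← hcast hb, ← Nat.card_congr (Equiv.ofBijective f hf), Nat.card_sigma, Nat.cast_sum]
  rw [Finset.sum_congr rfl fun W _ => by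
    rw [hcast (hfin W).ge, hfin W]]
  rw [Finset.sum_const, nsmul_eq_mul, Nat.card_eq_fintype_card (α := {W // _}), Finset.card_univ]

variable {R : Type*} [CommRing R] {M : Type*} [AddCommGroup M] [Module R M]

/-- The number of submodules of cardinality `m`. -/
def submoduleCount (R M : Type*) [CommRing R] [AddCommGroup M] [Module R M] (m : ℕ) : ℕ :=
  Nat.card {W : Submodule R M // Nat.card W = m}

/-- Since `I` kills `M`, the `R`-submodules are the subspaces over the residue field `R ⧸ I`. -/
theorem submoduleCount_mul [Finite M] {I : Ideal R} [hI : I.IsMaximal] [Finite (R ⧸ I)]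
    (hM : ∀ x ∈ I, ∀ m : M, x • m = 0) {a b : ℕ} (ha : Nat.card M = Nat.card (R ⧸ I) ^ a)
    (hb : b ≤ a) :
    (submoduleCount R M (Nat.card (R ⧸ I) ^ b) : ℂ) *
        ∏ e ∈ Finset.range b, ((Nat.card (R ⧸ I) : ℂ) ^ b - (Nat.card (R ⧸ I) : ℂ) ^ e) =
      ∏ e ∈ Finset.range b, ((Nat.card (R ⧸ I) : ℂ) ^ a - (Nat.card (R ⧸ I) : ℂ) ^ e) := by
  have ht : Module.IsTorsionBySet R M I := fun m x => hM x x.2 m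
  let : Field (R ⧸ I) := Ideal.Quotient.field I
  let : Module (R ⧸ I) M := ht.module
  have : IsScalarTower R (R ⧸ I) M := ht.isScalarTower
  have hfin : Module.finrank (R ⧸ I) M = a :=
    Nat.pow_right_injective (Finite.one_lt_card (α := R ⧸ I))
      ((Module.natCard_eq_pow_finrank (K := R ⧸ I) (V := M)).symm.trans ha)
  have e : {W : Submodule R M // Nat.card W = Nat.card (R ⧸ I) ^ b} ≃
      {W : Submodule (R ⧸ I) M // Nat.card W = Nat.card (R ⧸ I) ^ b} :=
    { toFun := fun W => ⟨{ W.1 with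
          smul_mem' := by
            intro c x hx
            obtain ⟨c, rfl⟩ := Ideal.Quotient.mk_surjective c
            rw [ht.mk_smul]
            exact W.1.smul_mem c hx }, W.2⟩
      invFun := fun W => ⟨W.1.restrictScalars R, W.2⟩
      left_inv := fun _ => rfl
      right_inv := fun _ => rfl }
  have := card_subspaces_mul (K := R ⧸ I) (V := M) (b := b) (by rw [hfin]; exact hb)
  rw [hfin] at this
  rw [submoduleCount, Nat.card_congr e]
  exact this

end Gaussian

/-! ### Submodules of a product of isotypic modules -/

section Isotypic

universe u v

variable {R : Type u} [CommRing R]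

section Single

variable {M P : Type*} [AddCommGroup M] [Module R M] [Finite M] [AddCommGroup P] [Module R P]
  {I : Ideal R} [hI : I.IsMaximal] [Finite (R ⧸ I)]

theorem homCard_eq_pow_left (hM : ∀ x ∈ I, ∀ m : M, x • m = 0) {b : ℕ}
    (hb : Nat.card M = Nat.card (R ⧸ I) ^ b) : homCard R M P = homCard R (R ⧸ I) P ^ b := by
  obtain ⟨e⟩ := nonempty_linearEquiv_pi_of_card hM hb
  rw [homCard_congr_left e, homCard_pi_left, Fintype.card_fin]

theorem homCard_eq_pow_right (hM : ∀ x ∈ I, ∀ m : M, x • m = 0) {b : ℕ}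
    (hb : Nat.card M = Nat.card (R ⧸ I) ^ b) : homCard R P M = homCard R P (R ⧸ I) ^ b := by
  obtain ⟨e⟩ := nonempty_linearEquiv_pi_of_card hM hb
  rw [homCard_congr_right e, homCard_pi_right, Fintype.card_fin]

theorem exponent_le {a b : ℕ} (ha : Nat.card M = Nat.card (R ⧸ I) ^ a) {W : Submodule R M}
    (hb : Nat.card W = Nat.card (R ⧸ I) ^ b) : b ≤ a := by
  have : Nat.card W ≤ Nat.card M := Finite.card_subtype_le _
  rw [ha, hb] at this
  have hnt : Nontrivial (R ⧸ I) := Ideal.Quotient.nontrivial_iff.mpr hI.ne_top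
  exact (Nat.pow_le_pow_iff_right (Finite.one_lt_card (α := R ⧸ I))).mp this

theorem homCard_quotient_eq_pow (hM : ∀ x ∈ I, ∀ m : M, x • m = 0) {a b : ℕ}
    (ha : Nat.card M = Nat.card (R ⧸ I) ^ a) {W : Submodule R M}
    (hb : Nat.card W = Nat.card (R ⧸ I) ^ b) :
    homCard R P (M ⧸ W) = homCard R P (R ⧸ I) ^ (a - b) := by
  have := finite_quotient W
  apply homCard_eq_pow_right
  · intro x hx m
    obtain ⟨m, rfl⟩ := W.mkQ_surjective m
    rw [← map_smul, hM x hx, map_zero]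
  · have h := Submodule.card_eq_card_quotient_mul_card W
    have hpos : 0 < Nat.card (R ⧸ I) ^ b := pow_pos Nat.card_pos _
    apply Nat.eq_of_mul_eq_mul_left hpos
    rw [← pow_add, Nat.add_sub_cancel' (exponent_le ha hb), ← ha, h, hb]

theorem finsum_submodule_eq_sum (hM : ∀ x ∈ I, ∀ m : M, x • m = 0) {a : ℕ}
    (ha : Nat.card M = Nat.card (R ⧸ I) ^ a) (f : Submodule R M → ℂ) (F : ℕ → ℂ)
    (h : ∀ (W : Submodule R M) b, Nat.card W = Nat.card (R ⧸ I) ^ b → f W = F b) :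
    ∑ᶠ W, f W =
      ∑ b ∈ Finset.range (a + 1), (submoduleCount R M (Nat.card (R ⧸ I) ^ b) : ℂ) * F b := by
  classical
  have := Fintype.ofFinite (Submodule R M)
  have hnt : Nontrivial (R ⧸ I) := Ideal.Quotient.nontrivial_iff.mpr hI.ne_top
  have hex : ∀ W : Submodule R M, ∃ b, Nat.card W = Nat.card (R ⧸ I) ^ b := fun W => by
    obtain ⟨b, hb, -⟩ := nonempty_linearEquiv_pi (R := R) (M := W) (I := I)
      (fun x hx m => Subtype.ext (hM x hx m))
    exact ⟨b, hb⟩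
  choose d hd using hex
  rw [finsum_eq_sum_of_fintype, ← Finset.sum_fiberwise_of_maps_to (t := Finset.range (a + 1))
    (g := d) (fun W _ => Finset.mem_range.mpr (Nat.lt_succ_of_le (exponent_le ha (hd W))))]
  apply Finset.sum_congr rfl
  intro b _
  have hiff : ∀ W, d W = b ↔ Nat.card W = Nat.card (R ⧸ I) ^ b := fun W => by
    rw [hd W, Nat.pow_right_inj (Finite.one_lt_card (α := R ⧸ I))]
  rw [submoduleCount, Nat.card_eq_fintype_card, Fintype.card_subtype, ← nsmul_eq_mul,
    ← Finset.sum_const]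
  simp only [hiff]
  exact Finset.sum_congr rfl fun W hW => h W b (Finset.mem_filter.mp hW).2

end Single

theorem sum_piFinset_range_succ {ℓ : ℕ} (a : Fin (ℓ + 1) → ℕ) (f : (Fin (ℓ + 1) → ℕ) → ℂ) :
    ∑ b ∈ Fintype.piFinset (fun r => Finset.range (a r + 1)), f b =
      ∑ b₀ ∈ Finset.range (a 0 + 1),
        ∑ b ∈ Fintype.piFinset (fun r : Fin ℓ => Finset.range (a r.succ + 1)),
          f (Fin.cons b₀ b) := by
  rw [← Finset.sum_product']
  symm
  apply Finset.sum_bij (fun x _ => (Fin.cons x.1 x.2 : Fin (ℓ + 1) → ℕ))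
  · rintro ⟨b₀, b⟩ h
    simp only [Finset.mem_product, Fintype.mem_piFinset] at h ⊢
    intro r
    refine Fin.cases ?_ (fun r => ?_) r
    · exact h.1
    · exact h.2 r
  · rintro ⟨b₀, b⟩ _ ⟨b₀', b'⟩ _ h
    have := Fin.cons_inj.mp h
    exact Prod.ext this.1 this.2
  · intro b h
    rw [Fintype.mem_piFinset] at h
    refine ⟨(b 0, fun r => b r.succ), ?_, Fin.cons_self_tail b⟩
    simp only [Finset.mem_product, Fintype.mem_piFinset]
    exact ⟨h 0, fun r => h r.succ⟩
  · intro _ _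
    rfl

/-- The test module `P` and the function `g` are there for the induction on `ℓ`; the count of
submodules of given size is the case `P = 0` with `g` an indicator function. -/
theorem finsum_submodule_pi [Finite R] [IsSemisimpleRing R] :
    ∀ {ℓ : ℕ} (E : Fin ℓ → Type v) [∀ r, AddCommGroup (E r)] [∀ r, Module R (E r)]
      [∀ r, Finite (E r)] (I : Fin ℓ → Ideal R) [∀ r, (I r).IsMaximal]
      (_ : ∀ r, ∀ x ∈ I r, ∀ m : E r, x • m = 0) (a : Fin ℓ → ℕ)
      (_ : ∀ r, Nat.card (E r) = Nat.card (R ⧸ I r) ^ a r)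
      (P : Type v) [AddCommGroup P] [Module R P] [Finite P] (g : ℕ → ℂ),
      ∑ᶠ W : Submodule R (∀ r, E r), (homCard R P ((∀ r, E r) ⧸ W) : ℂ) * g (Nat.card W) =
        ∑ b ∈ Fintype.piFinset (fun r => Finset.range (a r + 1)),
          (∏ r, (submoduleCount R (E r) (Nat.card (R ⧸ I r) ^ b r) : ℂ) *
            (homCard R P (R ⧸ I r) : ℂ) ^ (a r - b r)) *
          (∏ r, ∏ s ∈ Finset.Ioi r,
            (homCard R (R ⧸ I r) (R ⧸ I s) : ℂ) ^ (b r * (a s - b s))) *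
          g (∏ r, Nat.card (R ⧸ I r) ^ b r) := by
  intro ℓ
  induction ℓ with
  | zero =>
    intro E _ _ _ I _ hM a ha P _ _ _ g
    have hs : Subsingleton (Submodule R (∀ r, E r)) := inferInstance
    let _ : Unique (Submodule R (∀ r, E r)) := ⟨⟨⊥⟩, fun _ => Subsingleton.elim _ _⟩
    rw [finsum_unique]
    have h1 : Nat.card (default : Submodule R (∀ r, E r)) = 1 := Nat.card_unique
    have h2 : homCard R P ((∀ r, E r) ⧸ (default : Submodule R (∀ r, E r))) = 1 := by
      have : Subsingleton ((∀ r, E r) ⧸ (default : Submodule R (∀ r, E r))) :=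
        (Submodule.mkQ_surjective _).subsingleton
      exact Nat.card_unique
    rw [h1, h2]
    simp
  | succ ℓ ih =>
    intro E _ _ _ I _ hM a ha P _ _ _ g
    have hRI : ∀ r, Finite (R ⧸ I r) := fun r => finite_quotient (I r)
    let e := Fin.consLinearEquiv R E
    rw [← finsum_comp_equiv (Submodule.orderIsoMapComap e).toEquiv]
    have h1 : ∀ W : Submodule R (E 0 × ∀ r : Fin ℓ, E r.succ),
        (homCard R P ((∀ r, E r) ⧸ (Submodule.orderIsoMapComap e).toEquiv W) : ℂ) *
          g (Nat.card ((Submodule.orderIsoMapComap e).toEquiv W)) =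
        ((homCard R P (E 0 ⧸ fstPart W) : ℂ) *
          (homCard R P ((∀ r : Fin ℓ, E r.succ) ⧸ sndPart W) : ℂ)) *
          g (Nat.card (fstPart W) * Nat.card (sndPart W)) := by
      intro W
      rw [← Nat.cast_mul, ← homCard_quotient_prod, ← card_submodule_prod]
      congr 2
      · have := homCard_congr_right (R := R) (P := P)
          (M := (E 0 × ∀ r : Fin ℓ, E r.succ) ⧸ W)
          (M' := (∀ r, E r) ⧸ (Submodule.orderIsoMapComap e).toEquiv W)
          (Submodule.Quotient.equiv W _ e rfl)
        rw [← this]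
      · exact (Nat.card_congr (e.submoduleMap W).toEquiv).symm
    rw [finsum_congr h1, finsum_submodule_prod (fun B A =>
      ((homCard R P (E 0 ⧸ B) : ℂ) * (homCard R P ((∀ r : Fin ℓ, E r.succ) ⧸ A) : ℂ)) *
          g (Nat.card B * Nat.card A))]
    have h2 : ∀ B : Submodule R (E 0), ∀ b₀, Nat.card B = Nat.card (R ⧸ I 0) ^ b₀ →
        ∑ᶠ A : Submodule R (∀ r : Fin ℓ, E r.succ),
          (homCard R B ((∀ r : Fin ℓ, E r.succ) ⧸ A) : ℂ) *
          (((homCard R P (E 0 ⧸ B) : ℂ) * (homCard R P ((∀ r : Fin ℓ, E r.succ) ⧸ A) : ℂ)) *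
          g (Nat.card B * Nat.card A)) =
        (homCard R P (R ⧸ I 0) : ℂ) ^ (a 0 - b₀) *
        ∑ b ∈ Fintype.piFinset (fun r : Fin ℓ => Finset.range (a r.succ + 1)),
          (∏ r : Fin ℓ, (submoduleCount R (E r.succ) (Nat.card (R ⧸ I r.succ) ^ b r) : ℂ) *
            ((homCard R (R ⧸ I 0) (R ⧸ I r.succ) : ℂ) ^ b₀ * (homCard R P (R ⧸ I r.succ) : ℂ)) ^
              (a r.succ - b r)) *
          (∏ r : Fin ℓ, ∏ s ∈ Finset.Ioi r,
            (homCard R (R ⧸ I r.succ) (R ⧸ I s.succ) : ℂ) ^ (b r * (a s.succ - b s))) *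
          g (Nat.card (R ⧸ I 0) ^ b₀ * ∏ r : Fin ℓ, Nat.card (R ⧸ I r.succ) ^ b r) := by
      intro B b₀ hB
      have hBI : ∀ x ∈ I 0, ∀ m : B, x • m = 0 := fun x hx m => Subtype.ext (hM 0 x hx m)
      -- The fibre size `#Hom(B, N/A)` is absorbed into the test module as `B × P`, and the
      -- cardinality of `B` into `g`.
      have := ih (fun r => E r.succ) (fun r => I r.succ) (fun r => hM r.succ)
        (fun r => a r.succ) (fun r => ha r.succ) (B × P)
        (fun m => g (Nat.card (R ⧸ I 0) ^ b₀ * m))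
      simp only [homCard_prod_left, homCard_eq_pow_left hBI hB, Nat.cast_mul, Nat.cast_pow] at this
      rw [← this]
      have hf := Fintype.ofFinite (Submodule R (∀ r : Fin ℓ, E r.succ))
      rw [finsum_eq_sum_of_fintype, finsum_eq_sum_of_fintype, Finset.mul_sum]
      apply Finset.sum_congr rfl
      intro A _
      rw [homCard_quotient_eq_pow (hM 0) (ha 0) hB, homCard_eq_pow_left hBI hB, hB]
      push_cast
      ring
    rw [finsum_submodule_eq_sum (hM 0) (ha 0) _ _ h2, sum_piFinset_range_succ]
    apply Finset.sum_congr rfl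
    intro b₀ _
    rw [Finset.mul_sum, Finset.mul_sum]
    apply Finset.sum_congr rfl
    intro b _
    simp only [Fin.prod_univ_succ, Fin.cons_zero, Fin.cons_succ, Fin.prod_Ioi_zero,
      Fin.prod_Ioi_succ, mul_pow, Finset.prod_mul_distrib, ← pow_mul]
    ring

end Isotypic

/-! ### Homomorphisms between residue rings, and kernels as maximal ideals -/

section QuotientHoms

variable {R : Type*} [CommRing R]

theorem homCard_quotient_self (I : Ideal R) : homCard R (R ⧸ I) (R ⧸ I) = Nat.card (R ⧸ I) := by
  apply Nat.card_eq_of_bijective (fun f : (R ⧸ I) →ₗ[R] R ⧸ I => f 1)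
  constructor
  · intro f g h
    apply LinearMap.ext
    intro y
    obtain ⟨c, rfl⟩ := Ideal.Quotient.mk_surjective y
    have hc : Ideal.Quotient.mk I c = c • (1 : R ⧸ I) := by
      rw [Algebra.smul_def, mul_one]
      rfl
    rw [hc, map_smul, map_smul]
    exact congrArg _ h
  · intro m
    exact ⟨LinearMap.mulLeft R m, by simp⟩

/-- An element of `I` outside `J` acts as zero on the source and injectively on the target. -/
theorem homCard_quotient_of_ne {I J : Ideal R} [hI : I.IsMaximal] [hJ : J.IsMaximal] (h : I ≠ J) :
    homCard R (R ⧸ I) (R ⧸ J) = 1 := by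
  obtain ⟨x, hxI, hxJ⟩ : ∃ x ∈ I, x ∉ J := by
    by_contra! hcon
    exact h (hI.eq_of_le hJ.ne_top hcon)
  have hzero : ∀ f : (R ⧸ I) →ₗ[R] R ⧸ J, f = 0 := by
    intro f
    apply LinearMap.ext
    intro y
    have h1 : x • y = 0 := by
      rw [Algebra.smul_def]
      have : algebraMap R (R ⧸ I) x = 0 := Ideal.Quotient.eq_zero_iff_mem.mpr hxI
      rw [this, zero_mul]
    have h2 : x • f y = 0 := by rw [← map_smul, h1, map_zero]
    rw [Algebra.smul_def] at h2
    have h3 : algebraMap R (R ⧸ J) x ≠ 0 := fun h0 => hxJ (Ideal.Quotient.eq_zero_iff_mem.mp h0)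
    exact (mul_eq_zero.mp h2).resolve_left h3
  have : Unique ((R ⧸ I) →ₗ[R] R ⧸ J) := ⟨⟨0⟩, hzero⟩
  exact Nat.card_unique

theorem isMaximal_ker {F : Type*} [Field F] [Algebra F R] [Finite R] {E : Type*} [Field E] [Algebra F E] (ρ : R →ₐ[F] E) :
    (RingHom.ker ρ).IsMaximal := by
  have := RingHom.ker_isPrime ρ
  exact IsArtinianRing.isMaximal_of_isPrime _

theorem adjoin_mk {F : Type*} [Field F] [Algebra F R] {x : R} (hx : Algebra.adjoin F {x} = ⊤) (I : Ideal R) :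
    Algebra.adjoin F {Ideal.Quotient.mkₐ F I x} = ⊤ := by
  rw [← Set.image_singleton, ← AlgHom.map_adjoin, hx, Algebra.map_top]
  exact (AlgHom.range_eq_top _).mpr (Ideal.Quotient.mkₐ_surjective F I)

end QuotientHoms

/-! ### Frobenius periods -/

theorem HasFrobeniusPeriod.map {M N : Type*} [Monoid M] [Monoid N] {q d : ℕ} {z : M}
    (hz : HasFrobeniusPeriod q d z) (f : M →* N) (hf : Function.Injective f) :
    HasFrobeniusPeriod q d (f z) := by
  intro i j
  rw [← map_pow, ← map_pow, hf.eq_iff]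
  exact hz i j

theorem HasFrobeniusPeriod.of_map {M N : Type*} [Monoid M] [Monoid N] {q d : ℕ} {z : M}
    (f : M →* N) (hf : Function.Injective f) (hz : HasFrobeniusPeriod q d (f z)) :
    HasFrobeniusPeriod q d z := by
  intro i j
  rw [← hf.eq_iff, map_pow, map_pow]
  exact hz i j

section Generator

variable {F : Type*} [Field F] [Fintype F]

/-- A generator of a finite extension of degree `d` has period `d`. -/
theorem hasFrobeniusPeriod_of_adjoin {K : Type*} [Field K] [Algebra F K] [Finite K] {y : K}
    (hy : Algebra.adjoin F {y} = ⊤) :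
    HasFrobeniusPeriod (Fintype.card F) (Module.finrank F K) y := by
  intro i j
  -- The Frobenius automorphism has order `[K : F]`, and its powers are determined by their values
  -- at the generator `y`.
  rw [← FiniteField.orderOf_frobeniusAlgEquivOfAlgebraic F K, ← pow_eq_pow_iff_modEq]
  have hpow : ∀ n (x : K), (FiniteField.frobeniusAlgEquivOfAlgebraic F K ^ n) x =
      x ^ Fintype.card F ^ n := fun n x => by
    rw [AlgEquiv.coe_pow, FiniteField.coe_frobeniusAlgEquivOfAlgebraic_iterate]
  constructor
  · intro h
    have : ((FiniteField.frobeniusAlgEquivOfAlgebraic F K ^ i : K ≃ₐ[F] K) : K →ₐ[F] K) =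
        (FiniteField.frobeniusAlgEquivOfAlgebraic F K ^ j : K ≃ₐ[F] K) := by
      apply AlgHom.ext_of_adjoin_eq_top hy
      rintro x rfl
      change (FiniteField.frobeniusAlgEquivOfAlgebraic F K ^ i) x =
        (FiniteField.frobeniusAlgEquivOfAlgebraic F K ^ j) x
      rw [hpow, hpow, h]
    exact AlgEquiv.ext fun x => DFunLike.congr_fun this x
  · intro h
    rw [← hpow, ← hpow, h]

/-- Two embeddings of a finite field extension differ by a power of the Frobenius. -/
theorem exists_pow_eq_of_algHom {K L : Type*} [Field K] [Algebra F K] [Finite K] [Field L]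
    [Algebra F L] (σ τ : K →ₐ[F] L) : ∃ c, ∀ y, τ y = σ y ^ Fintype.card F ^ c := by
  have hinj : Function.Injective fun n : Fin (Module.finrank F K) =>
      σ.comp (FiniteField.frobeniusAlgHom F K ^ n.1) := by
    intro m n h
    apply (FiniteField.bijective_frobeniusAlgHom_pow F K).1
    apply AlgHom.ext
    intro y
    exact σ.injective (DFunLike.congr_fun h y)
  obtain ⟨n, hn⟩ := (hinj.bijective_of_nat_card_le
    ((card_algHom_le_finrank F K L).trans_eq (by simp))).2 τ
  refine ⟨n, fun y => ?_⟩
  rw [← hn, ← map_pow]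
  change σ ((FiniteField.frobeniusAlgHom F K ^ n.1) y) = _
  rw [AlgHom.coe_pow, FiniteField.coe_frobeniusAlgHom, pow_iterate]

variable {R : Type*} [CommRing R] [Finite R] [Algebra F R] {x : R}

theorem hasFrobeniusPeriod_apply (hx : Algebra.adjoin F {x} = ⊤) {E : Type*} [Field E]
    [Algebra F E] (ρ : R →ₐ[F] E) :
    HasFrobeniusPeriod (Fintype.card F) (Module.finrank F (R ⧸ RingHom.ker ρ)) (ρ x) := by
  have := isMaximal_ker ρ
  let _ : Field (R ⧸ RingHom.ker ρ) := Ideal.Quotient.field _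
  have := finite_quotient (RingHom.ker ρ)
  exact (hasFrobeniusPeriod_of_adjoin (adjoin_mk hx (RingHom.ker ρ))).map
    ((Ideal.kerLiftAlg ρ : _ →ₐ[F] E) : _ →* E) (Ideal.kerLiftAlg_injective ρ)

theorem card_quotient_ker {E : Type*} [Field E] [Algebra F E] (ρ : R →ₐ[F] E) :
    Nat.card (R ⧸ RingHom.ker ρ) =
      Fintype.card F ^ Module.finrank F (R ⧸ RingHom.ker ρ) := by
  have := finite_quotient (RingHom.ker ρ)
  rw [Module.natCard_eq_pow_finrank (K := F), Nat.card_eq_fintype_card]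

/-- This translates equality of the ideals `I_r` into conjugacy of the coordinates of `u` under
Frobenius. If the kernels agree, both maps are embeddings of the same residue field. -/
theorem ker_eq_ker_iff (hx : Algebra.adjoin F {x} = ⊤) {L : Type*} [Field L] [Algebra F L]
    (σ τ : R →ₐ[F] L) :
    RingHom.ker σ = RingHom.ker τ ↔ ∃ c, τ x = σ x ^ Fintype.card F ^ c := by
  constructor
  · intro h
    have := isMaximal_ker σ
    let _ : Field (R ⧸ RingHom.ker σ) := Ideal.Quotient.field _
    have := finite_quotient (RingHom.ker σ)
    obtain ⟨c, hc⟩ := exists_pow_eq_of_algHom (F := F) (Ideal.kerLiftAlg σ)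
      (Ideal.Quotient.liftₐ (RingHom.ker σ) τ (fun a ha => by rwa [h] at ha))
    exact ⟨c, hc (Ideal.Quotient.mk _ x)⟩
  · rintro ⟨c, hc⟩
    have hτ : τ = (FiniteField.frobeniusAlgHom F L ^ c).comp σ := by
      apply AlgHom.ext_of_adjoin_eq_top hx
      rintro y rfl
      rw [hc, AlgHom.comp_apply, AlgHom.coe_pow, FiniteField.coe_frobeniusAlgHom, pow_iterate]
    ext y
    rw [RingHom.mem_ker, RingHom.mem_ker, hτ, AlgHom.comp_apply]
    exact (map_eq_zero (FiniteField.frobeniusAlgHom F L ^ c)).symm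

end Generator

/-! ### Fixed points of the torus as submodules -/

section FixedPoints

variable {F : Type*} [Field F] [Fintype F] {ℓ : ℕ} {E : Fin ℓ → Type*} [∀ r, Field (E r)]
  [∀ r, Algebra F (E r)] [∀ r, Finite (E r)]

/-- Stability under `x` is stability under `F[x] = R`. Conversely, `u W ⊆ W` forces equality by
dimension. -/
theorem card_fixedBy {R : Type*} [CommRing R] [Algebra F R] [∀ r, Module R (E r)]
    [∀ r, IsScalarTower F R (E r)] {x : R} (hx : Algebra.adjoin F {x} = ⊤)
    (u : ∀ r, (E r)ˣ) (hu : ∀ r (e : E r), x • e = u r * e) (k : ℕ) :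
    Nat.card (MulAction.fixedBy (Gr F k (∀ r, E r)) u) =
      Nat.card {W : Submodule R (∀ r, E r) // Nat.card W = Fintype.card F ^ k} := by
  have hsmul : ∀ v : ∀ r, E r, x • v = torusMap F u v := fun v => funext fun r => hu r (v r)
  have hcard : ∀ W : Submodule F (∀ r, E r),
      Nat.card W = Fintype.card F ^ k ↔ Module.finrank F W = k := fun W => by
    rw [Module.natCard_eq_pow_finrank (K := F), Nat.card_eq_fintype_card,
      Nat.pow_right_inj Fintype.one_lt_card]
  have hrank : ∀ W : Submodule R (∀ r, E r), Nat.card W = Fintype.card F ^ k →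
      Module.finrank F (W.restrictScalars F) = k := fun W h => (hcard (W.restrictScalars F)).mp h
  apply Nat.card_congr
  exact
    { toFun := fun W => ⟨{ W.1.1 with
          smul_mem' := by
            intro c v hv
            have hc : c ∈ Algebra.adjoin F {x} := hx ▸ Algebra.mem_top
            have hv' : v ∈ W.1.1 := hv
            change c • v ∈ W.1.1
            induction hc using Algebra.adjoin_induction generalizing v with
            | mem y hy =>
              obtain rfl : y = x := hy
              have h : W.1.1.map (torusMap F u) = W.1.1 := congrArg Subtype.val W.2
              rw [hsmul, ← h]
              exact Submodule.mem_map_of_mem hv'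
            | algebraMap t =>
              rw [algebraMap_smul]
              exact W.1.1.smul_mem t hv'
            | add a b _ _ ha hb =>
              rw [add_smul]
              exact W.1.1.add_mem (ha hv hv') (hb hv hv')
            | mul a b _ _ ha hb =>
              rw [mul_smul]
              exact ha (hb hv hv') (hb hv hv') }, (hcard W.1.1).mpr W.1.2⟩
      invFun := fun W => ⟨⟨W.1.restrictScalars F, hrank W.1 W.2⟩, by
        apply Subtype.ext
        apply Submodule.eq_of_le_of_finrank_eq
        · rintro _ ⟨v, hv, rfl⟩
          rw [← hsmul]
          exact W.1.smul_mem x hv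
        · let G : Gr F k (∀ r, E r) := ⟨W.1.restrictScalars F, hrank W.1 W.2⟩
          exact (u • G).2.trans G.2.symm⟩
      left_inv := fun _ => rfl
      right_inv := fun _ => rfl }

end FixedPoints

/-! ### The sieving identity -/

theorem aeval_sievingPolynomial {ℓ : ℕ} (q n k : ℕ) (hk : k ≤ n) (α : Fin ℓ → ℕ)
    (hn : ∑ r, α r = n) (z : Fin ℓ → ℂ) :
    aeval z (sievingPolynomial q n k α) =
      ∑ β ∈ (Fintype.piFinset fun r => Finset.range (α r + 1)).filter (fun β => ∑ r, β r = k),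
        (∏ r, subsetSum q (z r) (blockCols α r) (β r)) *
          ∏ r, ∏ s ∈ Finset.Ioi r, boxWeight q (z r) (z s) (β r) (α s - β s) := by
  have h1 : ∀ r C m, aeval z (subsetSum q (X r : MvPolynomial (Fin ℓ) ℤ) C m) =
      subsetSum q (z r) C m := fun r C m => by
    have := map_subsetSum (aeval z : MvPolynomial (Fin ℓ) ℤ →ₐ[ℤ] ℂ).toRingHom q (X r) C m
    simpa using this
  have h2 : ∀ r s m m', aeval z (boxWeight q (X r : MvPolynomial (Fin ℓ) ℤ) (X s) m m') =
      boxWeight q (z r) (z s) m m' := fun r s m m' => by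
    simp only [boxWeight, map_prod]
    refine Finset.prod_congr rfl fun j _ => Finset.prod_congr rfl fun i _ => ?_
    have := map_qNumber (aeval z : MvPolynomial (Fin ℓ) ℤ →ₐ[ℤ] ℂ).toRingHom q
      ((X r : MvPolynomial (Fin ℓ) ℤ) ^ q ^ (i + j)) (X s ^ q ^ (i + m))
    simpa using this
  rw [sievingPolynomial_eq q n k hk α hn, map_sum]
  simp only [map_mul, map_prod, h1, h2]

/-- The value of the sieving polynomial at a family of roots of unity `z r` of period `d r`, in
terms of any numbers `G r b` that satisfy the recursion of the Gaussian binomial coefficients. -/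
theorem aeval_sievingPolynomial_of_period {ℓ : ℕ} {q n k : ℕ} (hq : 1 < q) (hk : k ≤ n)
    (α d a : Fin ℓ → ℕ) (hd : ∀ r, 0 < d r) (ha : ∀ r, α r = d r * a r)
    (hn : ∑ r, α r = n) (z : Fin ℓ → ℂ) (hz0 : ∀ r, z r ≠ 0)
    (hz : ∀ r, HasFrobeniusPeriod q (d r) (z r)) (G : Fin ℓ → ℕ → ℂ)
    (hG : ∀ r, ∀ b ≤ a r,
      G r b * ∏ e ∈ Finset.range b, (((q : ℂ) ^ d r) ^ b - ((q : ℂ) ^ d r) ^ e) =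
        ∏ e ∈ Finset.range b, (((q : ℂ) ^ d r) ^ a r - ((q : ℂ) ^ d r) ^ e))
    (H : Fin ℓ → Fin ℓ → ℂ)
    (hH : ∀ r s, (d r = d s ∧ (∃ c, z s = z r ^ q ^ c) ∧ H r s = (q : ℂ) ^ d r) ∨
      ((∀ i j, z r ^ q ^ i ≠ z s ^ q ^ j) ∧ H r s = 1)) :
    aeval z (sievingPolynomial q n k α) =
      ∑ b ∈ Fintype.piFinset (fun r => Finset.range (a r + 1)),
        (∏ r, G r (b r)) * (∏ r, ∏ s ∈ Finset.Ioi r, H r s ^ (b r * (a s - b s))) *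
          (if ∑ r, d r * b r = k then 1 else 0) := by
  have hle : ∀ r b, d r * b < α r + 1 ↔ b < a r + 1 := fun r b => by
    rw [Nat.lt_succ_iff, Nat.lt_succ_iff, ha, Nat.mul_le_mul_left_iff (hd r)]
  rw [aeval_sievingPolynomial q n k hk α hn]
  simp only [mul_ite, mul_one, mul_zero]
  rw [← Finset.sum_filter]
  symm
  -- Only `β = d b` contributes: if some `d r ∤ β r`, the diagonal sum of block `r` vanishes.
  apply Finset.sum_of_injOn (fun b r => d r * b r)
  · intro b _ b' _ h
    funext r
    exact Nat.eq_of_mul_eq_mul_left (hd r) (congrFun h r)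
  · intro b hb
    simp only [Finset.coe_filter, Fintype.mem_piFinset, Finset.mem_range, Set.mem_ofPred_eq,
      hle] at hb ⊢
    exact hb
  · intro β hβ hβ'
    simp only [Finset.mem_filter, Fintype.mem_piFinset, Finset.mem_range] at hβ
    have : ∃ r, ¬ d r ∣ β r := by
      by_contra! hcon
      choose b hb using hcon
      apply hβ'
      refine ⟨b, ?_, funext fun r => (hb r).symm⟩
      simp only [Finset.coe_filter, Fintype.mem_piFinset, Finset.mem_range, Set.mem_ofPred_eq,
        ← hle, ← hb]
      exact hβ
    obtain ⟨r, hr⟩ := this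
    rw [Finset.prod_eq_zero (Finset.mem_univ r), zero_mul]
    apply subsetSum_eq_zero hq (hd r) _ _ (hz0 r) (hz r) hr
    · rw [card_blockCols]
      exact Nat.lt_succ_iff.mp (hβ.1 r)
    · rw [card_blockCols, ha]
      exact dvd_mul_right _ _
  · intro b hb
    simp only [Finset.mem_filter, Fintype.mem_piFinset, Finset.mem_range] at hb
    congr 1
    · apply Finset.prod_congr rfl
      intro r _
      have hb' : b r ≤ a r := Nat.lt_succ_iff.mp (hb.1 r)
      have h1 := subsetSum_mul_prod_of_dvd hq (hd r) hb'
        ((card_blockCols α r).trans (ha r)) (hz0 r) (hz r)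
      rw [← hG r (b r) hb'] at h1
      refine (mul_right_cancel₀ ?_ h1).symm
      rw [Finset.prod_ne_zero_iff]
      intro e he
      rw [sub_ne_zero, ← pow_mul, ← pow_mul]
      exact_mod_cast (Nat.pow_lt_pow_right hq
        (Nat.mul_lt_mul_of_pos_left (Finset.mem_range.mp he) (hd r))).ne'
    · apply Finset.prod_congr rfl
      intro r _
      apply Finset.prod_congr rfl
      intro s _
      rw [ha s, ← Nat.mul_sub]
      rcases hH r s with ⟨hds, ⟨c, hc⟩, hHrs⟩ | ⟨hne, hHrs⟩
      · rw [hHrs, boxWeight_of_conj (by omega) (hd r) (hz0 r) (hz r) (hds ▸ hz s)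
          (hds ▸ dvd_mul_right _ _) hc, ← pow_mul, hds]
        congr 1
        ring
      · rw [hHrs, one_pow, boxWeight_of_ne (hz r) (hz s) (dvd_mul_right _ _) (dvd_mul_right _ _)
          hne]

section Main

universe u v

variable {F : Type u} [Field F] [Fintype F] {ℓ : ℕ} {E : Fin ℓ → Type v} [∀ r, Field (E r)]
  [∀ r, Algebra F (E r)]

theorem homCard_punit {R M : Type*} [CommRing R] [AddCommGroup M] [Module R M] :
    homCard R PUnit M = 1 := Nat.card_unique

theorem card_fixedBy_eq_sum [∀ r, Finite (E r)] {R : Type*} [CommRing R] [Algebra F R] [Finite R]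
    [IsReduced R] {x : R} (hx : Algebra.adjoin F {x} = ⊤) (ρ : ∀ r, R →ₐ[F] E r)
    (c : ∀ r, (E r)ˣ) (hc : ∀ r, ρ r x = c r) (k : ℕ) (d : Fin ℓ → ℕ)
    (hd : ∀ r, d r = Module.finrank F (R ⧸ RingHom.ker (ρ r))) :
    ∃ a : Fin ℓ → ℕ, (∀ r, Module.finrank F (E r) = d r * a r) ∧
      ∃ G : Fin ℓ → ℕ → ℂ,
        (∀ r, ∀ b ≤ a r,
          G r b * ∏ e ∈ Finset.range b, (((Fintype.card F : ℂ) ^ d r) ^ b -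
              ((Fintype.card F : ℂ) ^ d r) ^ e) =
            ∏ e ∈ Finset.range b, (((Fintype.card F : ℂ) ^ d r) ^ a r -
              ((Fintype.card F : ℂ) ^ d r) ^ e)) ∧
        (Nat.card (MulAction.fixedBy (Gr F k (∀ r, E r)) c) : ℂ) =
          ∑ b ∈ Fintype.piFinset (fun r => Finset.range (a r + 1)),
            (∏ r, G r (b r)) *
              (∏ r, ∏ s ∈ Finset.Ioi r,
                (homCard R (R ⧸ RingHom.ker (ρ r)) (R ⧸ RingHom.ker (ρ s)) : ℂ) ^
                  (b r * (a s - b s))) *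
              (if ∑ r, d r * b r = k then 1 else 0) := by
  have hq : 1 < Fintype.card F := Fintype.one_lt_card
  -- Through `ρ r` the generator `x` acts on `E r` as multiplication by `c r`.
  let _ : ∀ r, Module R (E r) := fun r => Module.compHom (E r) (ρ r : R →+* E r)
  have hsmul : ∀ r (y : R) (m : E r), y • m = ρ r y * m := fun _ _ _ => rfl
  have _ : ∀ r, IsScalarTower F R (E r) := fun r => ⟨fun t y m => by
    rw [hsmul, hsmul, map_smul, smul_mul_assoc]⟩
  have hmax : ∀ r, (RingHom.ker (ρ r)).IsMaximal := fun r => isMaximal_ker (ρ r)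
  have hfin : ∀ r, Finite (R ⧸ RingHom.ker (ρ r)) := fun r => finite_quotient _
  have hM : ∀ r, ∀ y ∈ RingHom.ker (ρ r), ∀ m : E r, y • m = 0 := fun r y hy m => by
    rw [hsmul, (RingHom.mem_ker).mp hy, zero_mul]
  have hQ : ∀ r, Nat.card (R ⧸ RingHom.ker (ρ r)) = Fintype.card F ^ d r := fun r => by
    rw [card_quotient_ker, hd]
  choose a ha _ using fun r => nonempty_linearEquiv_pi (R := R) (M := E r) (hM r)
  have hss : IsSemisimpleRing R := IsArtinianRing.isSemisimpleRing_of_isReduced R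
  refine ⟨a, fun r => ?_, fun r b => (submoduleCount R (E r)
    (Nat.card (R ⧸ RingHom.ker (ρ r)) ^ b) : ℂ), fun r b hb => ?_, ?_⟩
  · have h1 := ha r
    rw [hQ, ← pow_mul, Module.natCard_eq_pow_finrank (K := F), Nat.card_eq_fintype_card] at h1
    exact Nat.pow_right_injective hq h1
  · have := submoduleCount_mul (hM r) (ha r) hb
    simpa only [hQ, Nat.cast_pow] using this
  · have h := finsum_submodule_pi E (fun r => RingHom.ker (ρ r)) hM a ha PUnit.{v + 1}
      (fun m => if m = Fintype.card F ^ k then 1 else 0)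
    simp only [homCard_punit, Nat.cast_one, one_pow, mul_one, one_mul] at h
    rw [card_fixedBy hx c (fun r e => by rw [hsmul, hc])]
    have hfs := Fintype.ofFinite (Submodule R (∀ r, E r))
    rw [finsum_eq_sum_of_fintype, Finset.sum_boole, ← Fintype.card_subtype,
      ← Nat.card_eq_fintype_card] at h
    rw [h]
    apply Finset.sum_congr rfl
    intro b _
    congr 1
    simp only [hQ, ← pow_mul, Finset.prod_pow_eq_pow_sum, Nat.pow_right_inj hq]

theorem sievesFor_of_embeddings (n k : ℕ) (hk : k ≤ n) (α : Fin ℓ → ℕ) (hα : ∀ r, 0 < α r)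
    (hn : ∑ r, α r = n) (hE : ∀ r, Module.finrank F (E r) = α r) {L : Type*} [Field L]
    [Algebra F L] (emb : ∀ r, E r →ₐ[F] L) (ω : Lˣ →* ℂˣ) (hω : Function.Injective ω) :
    SievesFor (Gr F k (∀ r, E r)) (sievingPolynomial (Fintype.card F) n k α)
      (fun r => ω.comp (Units.map (emb r : E r →* L))) := by
  intro c
  have hq : 1 < Fintype.card F := Fintype.one_lt_card
  have _ : ∀ r, Module.Finite F (E r) := fun r =>
    Module.finite_of_finrank_pos (by rw [hE]; exact hα r)
  have _ : ∀ r, Finite (E r) := fun r => Module.finite_of_finite F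
  let A : Subalgebra F (∀ r, E r) := Algebra.adjoin F {fun r => (c r : E r)}
  let x : A := ⟨fun r => (c r : E r), Algebra.subset_adjoin rfl⟩
  have hx : Algebra.adjoin F {x} = ⊤ := by
    rw [← Algebra.adjoin_adjoin_coe_preimage (R := F) (s := {fun r => (c r : E r)})]
    congr 1
    ext y
    exact Subtype.ext_iff
  have hred : IsReduced A := isReduced_of_injective A.val Subtype.val_injective
  let ρ : ∀ r, A →ₐ[F] E r := fun r => (Pi.evalAlgHom F E r).comp A.val
  let d : Fin ℓ → ℕ := fun r => Module.finrank F (A ⧸ RingHom.ker (ρ r))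
  have hρ : ∀ r, ρ r x = c r := fun r => rfl
  obtain ⟨a, ha, G, hG, hcount⟩ := card_fixedBy_eq_sum hx ρ c hρ k d (fun _ => rfl)
  have hfinq : ∀ r, Finite (A ⧸ RingHom.ker (ρ r)) := fun r => finite_quotient _
  have hmax : ∀ r, (RingHom.ker (ρ r)).IsMaximal := fun r => isMaximal_ker (ρ r)
  have hd : ∀ r, 0 < d r := fun r => by
    have : Nontrivial (A ⧸ RingHom.ker (ρ r)) :=
      Ideal.Quotient.nontrivial_iff.mpr (hmax r).ne_top
    exact Module.finrank_pos
  let f : ∀ r, (E r)ˣ →* ℂ := fun r =>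
    (Units.coeHom ℂ).comp (ω.comp (Units.map (emb r : E r →* L)))
  have hf : ∀ r, Function.Injective (f r) := fun r =>
    Units.val_injective.comp (hω.comp (Units.map_injective (emb r).injective))
  have hz : ∀ r, HasFrobeniusPeriod (Fintype.card F) (d r) (f r (c r)) := fun r =>
    ((hasFrobeniusPeriod_apply hx (ρ r)).of_map (z := c r) (Units.coeHom (E r))
      Units.val_injective).map (f r) (hf r)
  have hker : ∀ r, RingHom.ker ((emb r).comp (ρ r)) = RingHom.ker (ρ r) := fun r => by
    ext y
    simp [RingHom.mem_ker]
  -- Here the common embedding is essential: one injective `ω` on `Lˣ` preserves and reflects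
  -- relations between different coordinates.
  have hconj : ∀ r s i j, f r (c r) ^ Fintype.card F ^ i = f s (c s) ^ Fintype.card F ^ j ↔
      (emb r (c r)) ^ Fintype.card F ^ i = (emb s (c s)) ^ Fintype.card F ^ j := by
    intro r s i j
    have h1 : ∀ r i, f r (c r) ^ Fintype.card F ^ i =
      ((ω ((Units.map (emb r : E r →* L) (c r)) ^ Fintype.card F ^ i) : ℂˣ) : ℂ) := by
      intro r i
      rw [map_pow, Units.val_pow_eq_pow_val]
      rfl
    rw [h1, h1, Units.val_inj, hω.eq_iff, Units.ext_iff, Units.val_pow_eq_pow_val,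
      Units.val_pow_eq_pow_val]
    rfl
  rw [hcount]
  apply aeval_sievingPolynomial_of_period hq hk α d a hd (fun r => (hE r).symm.trans (ha r)) hn
    _ (fun r => Units.ne_zero _) hz G hG
  intro r s
  by_cases h : RingHom.ker (ρ r) = RingHom.ker (ρ s)
  · left
    have hex := (ker_eq_ker_iff hx ((emb r).comp (ρ r)) ((emb s).comp (ρ s))).mp
      (by rw [hker, hker, h])
    obtain ⟨i, hi⟩ := hex
    have h2 := (hconj r s i 0).mpr (by rw [pow_zero, pow_one]; exact hi.symm)
    rw [pow_zero, pow_one] at h2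
    refine ⟨congrArg (fun I : Ideal A => Module.finrank F (A ⧸ I)) h, ⟨i, h2.symm⟩, ?_⟩
    rw [← h, homCard_quotient_self, card_quotient_ker, Nat.cast_pow]
  · right
    refine ⟨?_, ?_⟩
    · intro i j hij
      have hij' : f r (c r) ^ Fintype.card F ^ i = f s (c s) ^ Fintype.card F ^ j := hij
      apply h
      rw [← hker r, ← hker s, ker_eq_ker_iff hx]
      -- A further `m = d_s j - j` Frobenius steps bring the right side of `hij` back to `f s (c
      -- s)`, since `d_s j` is a multiple of its period.
      have h1 := (hz s).pow_eq_self (dvd_mul_right (d s) j)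
      obtain ⟨m, hm⟩ := Nat.exists_eq_add_of_le (Nat.le_mul_of_pos_left j (hd s))
      rw [hm, pow_add, pow_mul, ← hij', ← pow_mul, ← pow_add] at h1
      have h2 := (hconj r s (i + m) 0).mp (by rw [pow_zero, pow_one]; exact h1)
      rw [pow_zero, pow_one] at h2
      exact ⟨i + m, h2.symm⟩
    · rw [homCard_quotient_of_ne h, Nat.cast_one]

end Main

/-! ### Existence of a common embedding -/

theorem exists_injective_unitsHom (L : Type*) [Field L] [Finite L] :
    ∃ ω : Lˣ →* ℂˣ, Function.Injective ω := by
  have hne : NeZero (Nat.card Lˣ) := ⟨Nat.card_pos.ne'⟩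
  have h : Nat.card Lˣ = Nat.card (rootsOfUnity (Nat.card Lˣ) ℂ) := by
    rw [Complex.card_rootsOfUnity]
  exact ⟨(Subgroup.subtype _).comp (mulEquivOfCyclicCardEq h).toMonoidHom,
    Subtype.val_injective.comp (mulEquivOfCyclicCardEq h).injective⟩

theorem exists_finite_extension (F : Type*) [Field F] [Finite F] {ℓ : ℕ} (E : Fin ℓ → Type*)
    [∀ r, Field (E r)] [∀ r, Algebra F (E r)] (hE : ∀ r, 0 < Module.finrank F (E r)) :
    ∃ (L : Type) (_ : Field L) (_ : Algebra F L), Finite L ∧ Nonempty (∀ r, E r →ₐ[F] L) := by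
  obtain ⟨p, hp⟩ := CharP.exists F
  have hprime : Fact p.Prime := ⟨CharP.char_is_prime F p⟩
  have hN : NeZero (∏ r, Module.finrank F (E r)) :=
    ⟨Finset.prod_ne_zero_iff.mpr fun r _ => (hE r).ne'⟩
  -- The product of the degrees is a convenient common multiple; divisibility of degrees suffices
  -- for an embedding of finite fields.
  refine ⟨FiniteField.Extension F p (∏ r, Module.finrank F (E r)), inferInstance, inferInstance,
    inferInstance, ⟨fun r => ?_⟩⟩
  have : Module.Finite F (E r) := Module.finite_of_finrank_pos (hE r)
  have : Finite (E r) := Module.finite_of_finite F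
  apply Nonempty.some
  apply FiniteField.nonempty_algHom_of_finrank_dvd
  rw [FiniteField.finrank_extension]
  exact Finset.dvd_prod_of_mem _ (Finset.mem_univ r)

end TorusSieving

end

theorem theorem2 {F : Type*} [Field F] [Fintype F] {ℓ : ℕ} (n k : ℕ) (hk : k ≤ n)
    (α : Fin ℓ → ℕ) (hα : ∀ r, 0 < α r) (hn : ∑ r, α r = n)
    (E : Fin ℓ → Type*) [∀ r, Field (E r)] [∀ r, Algebra F (E r)]
    (hE : ∀ r, Module.finrank F (E r) = α r) :
    TorusSieving.ExhibitsCSP (TorusSieving.Gr F k (∀ r, E r))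
        (TorusSieving.sievingPolynomial (Fintype.card F) n k α) (fun r => (E r)ˣ) ∧
      ∀ (L : Type*) [Field L] [Algebra F L] (emb : ∀ r, E r →ₐ[F] L) (ω : Lˣ →* ℂˣ),
        Function.Injective ω →
        TorusSieving.SievesFor (TorusSieving.Gr F k (∀ r, E r))
          (TorusSieving.sievingPolynomial (Fintype.card F) n k α)
          (fun r => ω.comp (Units.map (emb r : E r →* L))) := by
  have hfin : ∀ r, Finite (E r) := fun r => by
    have : Module.Finite F (E r) := Module.finite_of_finrank_pos (by rw [hE]; exact hα r)
    exact Module.finite_of_finite F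
  refine ⟨⟨?_, fun r => ⟨inferInstance, inferInstance⟩, ?_⟩, fun L _ _ emb ω hω =>
    TorusSieving.sievesFor_of_embeddings n k hk α hα hn hE emb ω hω⟩
  · exact Subtype.finite
  · obtain ⟨L, _, _, _, ⟨emb⟩⟩ := TorusSieving.exists_finite_extension F E
      (fun r => by rw [hE]; exact hα r)
    obtain ⟨ω, hω⟩ := TorusSieving.exists_injective_unitsHom L
    exact ⟨fun r => ω.comp (Units.map (emb r : E r →* L)),
      fun r => hω.comp (Units.map_injective (emb r).injective),
      TorusSieving.sievesFor_of_embeddings n k hk α hα hn hE emb ω hω⟩
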